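/- Let $H$ and $U$ be real Hilbert spaces, let $A : D(A)\subset H\to H$ be the generator of a strongly continuous semigroup of contractions on $H$, let $B : U\to H$ be a bounded linear operator with adjoint $B^\star$, and let $k>0$. For a linear operator $L$ put $\|z\|_{D(L)}=\|z\|_H+\|Lz\|_H$ for $z\in D(L)$. Let $\sigma : U\to U$ satisfy: 1. $\sigma$ is locally Lipschitz and maps bounded sets to bounded sets (both hold if $\sigma$ is Lipschitz on bounded sets); 2. $\langle \sigma(s_1)-\sigma(s_2),s_1-s_2\rangle_U\ge 0$ for all $s_1,s_2\in U$; 3. there are constants $C_1,C_2>0$ and a continuous non-decreasing function $h:\mathbb R\to[0,\infty)$ with $h(0)>0$ such that $\|\sigma(s)-C_1s\|_U\le C_2\,h(\|s\|_U)\,\langle\sigma(s),s\rangle_U$ for all $s\in U$. Assume that the linear closed loop $z'=\tilde A z$, $\tilde A=A-kBB^\star$, $D(\tilde A)=D(A)$, is $1$-globally polynomially stable with some $\gamma>\frac12$: there is $C>0$ with $$\|e^{t\tilde A}z_0\|_H\le \frac{C}{(1+t)^{\gamma}}\|z_0\|_{D(\tilde A)}\qquad\text{for all } z_0\in D(A),\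 t\ge 0.$$ Consider the nonlinear closed loop $$z'=A_\sigma(z),\qquad A_\sigma(z)=Az-\sqrt k\,B\,\sigma(\sqrt k\,B^\star z),\qquad D(A_\sigma)=D(A).$$ A strong solution is a function $z:[0,\infty)\to H$ that is locally absolutely continuous, takes values in $D(A)$, and satisfies the equation for almost every $t>0$. Then for every $z_0\in D(A)$ there is exactly one strong solution $t\mapsto W_\sigma(t)z_0$ with initial value $z_0$, and the origin is semi-globally polynomially stable in $D(A)$ with rate $\frac12$: for every $r>0$ there is a constant $C(r)>0$ such that, for all $z_0\in D(A)$ with $\|z_0\|_{D(A)}\le r$, $$\|W_\sigma(t)z_0\|_H\le\frac{C(r)}{(1+t)^{1/2}}\,\|z_0\|_{D(A)}\qquad\text{for all } t\ge 0.$$ -/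

import Mathlib

open Filter Topology MeasureTheory

noncomputable section

namespace NonlinearDamping

variable {H U : Type*} [NormedAddCommGroup H] [InnerProductSpace ℝ H] [CompleteSpace H]
  [NormedAddCommGroup U] [InnerProductSpace ℝ U] [CompleteSpace U]

/-- `T` restricted to `[0, ∞)` is a strongly continuous semigroup of contractions on `H`
(the values at negative times play no role). -/
structure IsContractionSemigroup (T : ℝ → H →L[ℝ] H) : Prop where
  zero : T 0 = ContinuousLinearMap.id ℝ H
  add : ∀ s t : ℝ, 0 ≤ s → 0 ≤ t → T (s + t) = (T s).comp (T t)
  continuous_zero : ∀ x : H, Tendsto (fun t => T t x) (𝓝[>] 0) (𝓝 x)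
  contraction : ∀ t : ℝ, 0 ≤ t → ∀ x : H, ‖T t x‖ ≤ ‖x‖

/-- `L` is the infinitesimal generator of `T`: `x` lies in the domain of `L` exactly when
`(T h x - x) / h` converges as `h ↓ 0`, and then the limit is `L x`. -/
def IsGenerator (L : H →ₗ.[ℝ] H) (T : ℝ → H →L[ℝ] H) : Prop :=
  ∀ x y : H, (x, y) ∈ L.graph ↔
    Tendsto (fun h : ℝ => h⁻¹ • (T h x - x)) (𝓝[>] 0) (𝓝 y)

/-- `L` generates a strongly continuous semigroup of contractions. -/
def GeneratesContractionSemigroup (L : H →ₗ.[ℝ] H) : Prop :=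
  ∃ T : ℝ → H →L[ℝ] H, IsContractionSemigroup T ∧ IsGenerator L T

/-- The graph norm `‖z‖ + ‖L z‖` on the domain of `L`. -/
def graphNorm (L : H →ₗ.[ℝ] H) (z : L.domain) : ℝ :=
  ‖(z : H)‖ + ‖L z‖

/-- The origin of `z' = L z` is `1`-globally polynomially stable with exponent `γ`:
`‖e^{tL} z₀‖ ≤ C (1 + t)^{-γ} ‖z₀‖_{D(L)}` for all `z₀ ∈ D(L)` and `t ≥ 0`. Here `e^{tL}` is the
contraction semigroup generated by `L`; it is determined by `L` on `[0, ∞)`, so that quantifying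
over all `T` generated by `L` just names it. The notion is meant for generators `L`. -/
def IsPolynomiallyStable (L : H →ₗ.[ℝ] H) (γ : ℝ) : Prop :=
  0 < γ ∧ ∃ C : ℝ, 0 < C ∧
    ∀ T : ℝ → H →L[ℝ] H, IsContractionSemigroup T → IsGenerator L T →
      ∀ z₀ : L.domain, ∀ t : ℝ, 0 ≤ t →
        ‖T t z₀‖ ≤ C / (1 + t) ^ γ * graphNorm L z₀

/-- The linear closed-loop operator `A - k B B⋆`, with domain `D(A)`. -/
def linearClosedLoop (A : H →ₗ.[ℝ] H) (B : U →L[ℝ] H) (k : ℝ) : H →ₗ.[ℝ] H where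
  domain := A.domain
  toFun := A.toFun -
    (k • (B.comp (ContinuousLinearMap.adjoint B)) : H →L[ℝ] H).toLinearMap.comp A.domain.subtype

/-- The nonlinear closed-loop operator `A_σ z = A z - √k B σ(√k B⋆ z)`, with domain `D(A)`. -/
def nonlinearClosedLoop (A : H →ₗ.[ℝ] H) (B : U →L[ℝ] H) (k : ℝ) (σ : U → U)
    (z : A.domain) : H :=
  A z - √k • B (σ (√k • ContinuousLinearMap.adjoint B z))

/-- Nonlinear damping functions on `U`, in the case `S = U` (so that `S' = U' = U`). -/
structure IsNonlinearDamping (σ : U → U) : Prop where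
  locallyLipschitz : LocallyLipschitz σ
  /-- Together with the previous item this is implied by Lipschitz continuity on bounded sets;
  it is automatic if `U` is finite-dimensional. -/
  bounded : ∀ s : Set U, Bornology.IsBounded s → Bornology.IsBounded (σ '' s)
  monotone : ∀ s₁ s₂ : U, 0 ≤ inner ℝ (σ s₁ - σ s₂) (s₁ - s₂)
  linear_bound : ∃ C₁ C₂ : ℝ, 0 < C₁ ∧ 0 < C₂ ∧ ∃ h : ℝ → ℝ,
    Continuous h ∧ Monotone h ∧ (∀ x, 0 ≤ h x) ∧ 0 < h 0 ∧
      ∀ s : U, ‖σ s - C₁ • s‖ ≤ C₂ * h ‖s‖ * inner ℝ (σ s) s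

/-- `z` is a strong solution on `[0, ∞)` of `z' = F z`, `z 0 = z₀`, where `F : D → H`: it is locally
absolutely continuous, stays in `D`, and satisfies the equation at almost every `t > 0`. -/
structure IsStrongSolution {D : Submodule ℝ H} (F : D → H) (z₀ : D) (z : ℝ → H) : Prop where
  init : z 0 = z₀
  absolutelyContinuous : ∀ T : ℝ, 0 < T → AbsolutelyContinuousOnInterval z 0 T
  mem : ∀ t : ℝ, 0 ≤ t → z t ∈ D
  eqn : ∀ᵐ t : ℝ, ∀ ht : 0 < t, HasDerivAt z (F ⟨z t, mem t ht.le⟩) t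

/-- `W` is the flow of `z' = F z`: for every `z₀ ∈ D`, `t ↦ W t z₀` is the unique strong solution
on `[0, ∞)` starting at `z₀`. -/
def IsStrongFlow {D : Submodule ℝ H} (F : D → H) (W : ℝ → D → H) : Prop :=
  ∀ z₀ : D, IsStrongSolution F z₀ (fun t => W t z₀) ∧
    ∀ w : ℝ → H, IsStrongSolution F z₀ w → ∀ t : ℝ, 0 ≤ t → w t = W t z₀

/-- The origin is semi-globally polynomially stable in `D(A)` with exponent `γ` for the flow `W`. -/
def IsSemiGloballyPolynomiallyStable (A : H →ₗ.[ℝ] H) (W : ℝ → A.domain → H) (γ : ℝ) : Prop :=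
  0 < γ ∧ ∀ r : ℝ, 0 < r → ∃ C : ℝ, 0 < C ∧
    ∀ z₀ : A.domain, graphNorm A z₀ ≤ r → ∀ t : ℝ, 0 ≤ t →
      ‖W t z₀‖ ≤ C / (1 + t) ^ γ * graphNorm A z₀

end NonlinearDamping

end

set_option linter.unusedSectionVars false

noncomputable section

namespace NonlinearDamping

open Set

variable {H U : Type*} [NormedAddCommGroup H] [InnerProductSpace ℝ H] [CompleteSpace H]
  [NormedAddCommGroup U] [InnerProductSpace ℝ U] [CompleteSpace U]

/-! ### Contraction semigroups -/

/-! On each window `[t, t + τ]` the nonlinear solution `z` is compared with the linear evolution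
`e^{τÃ} z(t)` restarted from its current state. Put `a = √k B⋆ z` and let `p = ⟨σ(a), a⟩` be the
dissipated power; the energy inequality gives `2 ∫ p ≤ ‖z(t)‖² - ‖z(t + τ)‖²`. On bounded sets `‖a -
σ(a)‖² ≤ c p` (`IsNonlinearDamping.exists_norm_sub_sq_le`), so the discrepancy between the two
feedbacks is paid for by lost energy (`norm_sub_sq_le_of_isMildOn`): `‖z(t + τ) - e^{τÃ} z(t)‖² ≤ (c
/ 4) (‖z(t)‖² - ‖z(t + τ)‖²)`.

The linear term satisfies `‖e^{τÃ} z(t)‖² ≤ const / (1 + τ)` uniformly in `t`, because the graph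
norm of `z(t)` is bounded by a multiple of that of `z₀`. Hence `E = ‖z‖²` satisfies `E(t + τ) ≤ q
E(t) + P / (1 + τ)` with `q < 1`. Taking `τ` proportional to `1 + t` forces `E = O(1 / (1 + t))`
(`exists_le_div_of_le_mul_add`), which is the rate `1/2` for `‖z‖`. Trajectories stay in the ball of
radius `r`, so all constants depend on `r` only.

Well-posedness goes through mild (Duhamel) solutions. Their energy inequality `norm_mildSol_sq_le`
and the monotonicity of `σ` make the solution map nonexpansive. This yields uniqueness, excludes
blow-up and, by comparing a trajectory with its own time shift, makes trajectories from the domain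
Lipschitz. Such trajectories remain in the domain with bounded graph norm and are differentiable
almost everywhere, hence strong solutions. -/

/-- The extension of a semigroup to negative times by its value at time `0`. -/
def extendSemigroup (T : ℝ → H →L[ℝ] H) (t : ℝ) : H →L[ℝ] H := T (max t 0)

theorem IsContractionSemigroup.norm_sub_le {T : ℝ → H →L[ℝ] H} (hT : IsContractionSemigroup T)
    (x : H) {s t : ℝ} (hs : 0 ≤ s) (hst : s ≤ t) : ‖T t x - T s x‖ ≤ ‖T (t - s) x - x‖ := by
  have h := hT.add s (t - s) hs (sub_nonneg.2 hst)
  rw [add_sub_cancel] at h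
  rw [h, ContinuousLinearMap.comp_apply, ← map_sub]
  exact hT.contraction s hs _

theorem IsContractionSemigroup.extend {T : ℝ → H →L[ℝ] H} (hT : IsContractionSemigroup T) :
    IsContractionSemigroup (extendSemigroup T) where
  zero := by simpa [extendSemigroup] using hT.zero
  add s t hs ht := by
    simpa [extendSemigroup, max_eq_left, hs, ht, add_nonneg hs ht] using hT.add s t hs ht
  continuous_zero x := by
    refine (hT.continuous_zero x).congr' ?_
    filter_upwards [self_mem_nhdsWithin] with t ht
    simp [extendSemigroup, max_eq_left (mem_Ioi.1 ht).le]
  contraction t ht x := hT.contraction _ (le_max_right _ _) x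

theorem IsGenerator.extend {L : H →ₗ.[ℝ] H} {T : ℝ → H →L[ℝ] H} (hL : IsGenerator L T) :
    IsGenerator L (extendSemigroup T) := by
  intro x y
  rw [hL x y]
  refine tendsto_congr' ?_
  filter_upwards [self_mem_nhdsWithin] with t ht
  simp [extendSemigroup, max_eq_left (mem_Ioi.1 ht).le]

/-- Right continuity at `0` gives two-sided continuity of orbits through `norm_sub_le`, and
contractivity makes it uniform in the state. Freezing negative times makes the Duhamel integrand
continuous on all of `ℝ`, which removes integrability side conditions later. -/
theorem IsContractionSemigroup.continuous_extend {T : ℝ → H →L[ℝ] H}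
    (hT : IsContractionSemigroup T) :
    Continuous fun p : ℝ × H => extendSemigroup T p.1 p.2 := by
  have horbit : ∀ x : H, Continuous fun t => extendSemigroup T t x := by
    intro x
    rw [Metric.continuous_iff]
    intro t ε hε
    have hx := hT.continuous_zero x
    rw [Metric.tendsto_nhdsWithin_nhds] at hx
    obtain ⟨δ, hδ, h⟩ := hx ε hε
    have key : ∀ s t : ℝ, 0 ≤ s → s ≤ t → t - s < δ → ‖T t x - T s x‖ < ε := by
      intro s t hs hst hlt
      rcases hst.eq_or_lt with rfl | hst'
      · simpa using hε
      · refine (hT.norm_sub_le x hs hst).trans_lt ?_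
        rw [← dist_eq_norm]
        refine h (sub_pos.2 hst') ?_
        rwa [Real.dist_eq, sub_zero, abs_of_pos (sub_pos.2 hst')]
    refine ⟨δ, hδ, fun s hst => ?_⟩
    have hmax : |max s 0 - max t 0| < δ := (abs_max_sub_max_le_abs s t 0).trans_lt hst
    rw [abs_lt] at hmax
    rw [dist_eq_norm]
    rcases le_total (max s 0) (max t 0) with hle | hle
    · rw [norm_sub_rev]
      exact key _ _ (le_max_right _ _) hle (by linarith)
    · exact key _ _ (le_max_right _ _) hle (by linarith)
  rw [continuous_iff_continuousAt]
  rintro ⟨t, x⟩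
  have h1 : Tendsto (fun p : ℝ × H => ‖p.2 - x‖ + ‖extendSemigroup T p.1 x - extendSemigroup T t x‖)
      (𝓝 (t, x)) (𝓝 0) := by
    have : Continuous fun p : ℝ × H =>
        ‖p.2 - x‖ + ‖extendSemigroup T p.1 x - extendSemigroup T t x‖ := by
      have := (horbit x).comp (continuous_fst (X := ℝ) (Y := H))
      simp only [Function.comp_def] at this
      fun_prop
    simpa using this.tendsto (t, x)
  refine tendsto_iff_norm_sub_tendsto_zero.2 (squeeze_zero (fun _ => norm_nonneg _) ?_ h1)
  rintro ⟨s, y⟩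
  have : extendSemigroup T s y - extendSemigroup T t x =
      extendSemigroup T s (y - x) + (extendSemigroup T s x - extendSemigroup T t x) := by
    simp
  rw [this]
  exact (norm_add_le _ _).trans (by gcongr; exact hT.contraction _ (le_max_right _ _) _)

section Mild

/-! ### Mild solutions of the inhomogeneous linear equation -/

/-- The mild solution `S t x + ∫₀ᵗ S (t - s) (f s) ds` of `u' = A u + f`, `u 0 = x`. -/
def mildSol (S : ℝ → H →L[ℝ] H) (x : H) (f : ℝ → H) (t : ℝ) : H :=
  S t x + ∫ s in (0 : ℝ)..t, S (t - s) (f s)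

variable {S : ℝ → H →L[ℝ] H}

theorem continuous_mildSol (hc : Continuous fun p : ℝ × H => S p.1 p.2) (x : H) {f : ℝ → H}
    (hf : Continuous f) : Continuous (mildSol S x f) := by
  have h1 : Continuous fun t => S t x := hc.comp (by fun_prop : Continuous fun t : ℝ => (t, x))
  have h2 : Continuous (Function.uncurry fun t s : ℝ => S (t - s) (f s)) :=
    hc.comp (by fun_prop : Continuous fun p : ℝ × ℝ => (p.1 - p.2, f p.2))
  exact h1.add
    (intervalIntegral.continuous_parametric_intervalIntegral_of_continuous h2 continuous_id)

theorem continuous_semigroup_comp (hc : Continuous fun p : ℝ × H => S p.1 p.2) {f : ℝ → H}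
    (hf : Continuous f) (t : ℝ) : Continuous fun s => S (t - s) (f s) :=
  hc.comp (by fun_prop : Continuous fun s : ℝ => (t - s, f s))

theorem mildSol_zero (hS : IsContractionSemigroup S) (x : H) (f : ℝ → H) :
    mildSol S x f 0 = x := by
  simp [mildSol, hS.zero]

theorem mildSol_congr (x : H) {f g : ℝ → H} {t : ℝ} (ht : 0 ≤ t)
    (h : ∀ s ∈ Icc 0 t, f s = g s) : mildSol S x f t = mildSol S x g t := by
  unfold mildSol
  congr 1
  refine intervalIntegral.integral_congr fun s hs => ?_
  rw [uIcc_of_le ht] at hs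
  simp only [h s hs]

theorem mildSol_sub (hc : Continuous fun p : ℝ × H => S p.1 p.2) (x y : H) {f g : ℝ → H}
    (hf : Continuous f) (hg : Continuous g) (t : ℝ) :
    mildSol S x f t - mildSol S y g t = mildSol S (x - y) (fun s => f s - g s) t := by
  unfold mildSol
  simp only [map_sub]
  rw [intervalIntegral.integral_sub ((continuous_semigroup_comp hc hf t).intervalIntegrable _ _)
    ((continuous_semigroup_comp hc hg t).intervalIntegrable _ _)]
  abel

/-- Mild solutions can be restarted at any time. -/
theorem mildSol_add (hS : IsContractionSemigroup S) (hc : Continuous fun p : ℝ × H => S p.1 p.2)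
    (x : H) {f : ℝ → H} (hf : Continuous f) {t h : ℝ} (ht : 0 ≤ t) (hh : 0 ≤ h) :
    mildSol S x f (t + h) = mildSol S (mildSol S x f t) (fun s => f (t + s)) h := by
  have hi := fun a b : ℝ =>
    (continuous_semigroup_comp hc hf (t + h)).intervalIntegrable (μ := volume) a b
  have h1 : S (t + h) x = S h (S t x) := by
    rw [add_comm, hS.add h t hh ht]; rfl
  have h2 : ∫ s in (0 : ℝ)..t, S (t + h - s) (f s) = S h (∫ s in (0 : ℝ)..t, S (t - s) (f s)) := by
    rw [← ContinuousLinearMap.intervalIntegral_comp_comm _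
      ((continuous_semigroup_comp hc hf t).intervalIntegrable _ _)]
    refine intervalIntegral.integral_congr fun s hs => ?_
    rw [uIcc_of_le ht] at hs
    have : t + h - s = h + (t - s) := by ring
    simp only [this]
    rw [hS.add h (t - s) hh (sub_nonneg.2 hs.2)]; rfl
  have h3 : ∫ s in t..(t + h), S (t + h - s) (f s) =
      ∫ s in (0 : ℝ)..h, S (h - s) (f (t + s)) := by
    have := intervalIntegral.integral_comp_add_left (a := 0) (b := h)
      (fun s => S (t + h - s) (f s)) t
    simp only [add_zero] at this
    rw [← this]
    refine intervalIntegral.integral_congr fun s _ => ?_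
    simp only [add_sub_add_left_eq_sub]
  unfold mildSol
  rw [← intervalIntegral.integral_add_adjacent_intervals (hi 0 t) (hi t (t + h)), h1, h2, h3,
    map_add]
  abel

theorem norm_mildSol_sub_semigroup_le (hS : IsContractionSemigroup S) (x : H) {f : ℝ → H} {t M : ℝ}
    (ht : 0 ≤ t) (hM : ∀ s ∈ Icc 0 t, ‖f s‖ ≤ M) : ‖mildSol S x f t - S t x‖ ≤ M * t := by
  rw [mildSol, add_sub_cancel_left]
  refine (intervalIntegral.norm_integral_le_of_norm_le_const (C := M) fun s hs => ?_).trans ?_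
  · rw [uIoc_of_le ht] at hs
    exact (hS.contraction _ (sub_nonneg.2 hs.2) _).trans (hM s ⟨hs.1.le, hs.2⟩)
  · rw [sub_zero, abs_of_nonneg ht]

/-- Only the Duhamel term is differentiated at `0`; with the free orbit subtracted, no assumption
that `x` lies in the domain is needed. -/
theorem tendsto_mildSol_sub_semigroup_div (hS : IsContractionSemigroup S)
    (hc : Continuous fun p : ℝ × H => S p.1 p.2) (x : H) {f : ℝ → H} (hf : Continuous f) :
    Tendsto (fun h : ℝ => h⁻¹ • (mildSol S x f h - S h x)) (𝓝[>] 0) (𝓝 (f 0)) := by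
  have hj : Continuous fun p : ℝ × ℝ => S (p.1 - p.2) (f p.2) :=
    hc.comp (by fun_prop : Continuous fun p : ℝ × ℝ => (p.1 - p.2, f p.2))
  rw [Metric.tendsto_nhdsWithin_nhds]
  intro ε hε
  have hj0 := (Metric.continuous_iff.1 hj) (0, 0) (ε / 2) (half_pos hε)
  simp only [sub_zero, hS.zero, ContinuousLinearMap.id_apply] at hj0
  obtain ⟨δ, hδ, h⟩ := hj0
  refine ⟨δ, hδ, fun {t} ht htδ => ?_⟩
  have ht0 : 0 < t := ht
  rw [Real.dist_eq, sub_zero, abs_of_pos ht0] at htδ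
  have hint : ‖(∫ s in (0 : ℝ)..t, S (t - s) (f s)) - t • f 0‖ ≤ ε / 2 * t := by
    have : t • f 0 = ∫ s in (0 : ℝ)..t, f 0 := by simp
    rw [this, ← intervalIntegral.integral_sub
      ((continuous_semigroup_comp hc hf t).intervalIntegrable _ _) (by simp)]
    refine (intervalIntegral.norm_integral_le_of_norm_le_const (C := ε / 2) fun s hs => ?_).trans ?_
    · rw [uIoc_of_le ht0.le] at hs
      rw [← dist_eq_norm]
      refine (h (t, s) ?_).le
      rw [Prod.dist_eq, Real.dist_eq, Real.dist_eq, sub_zero, sub_zero, abs_of_pos ht0,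
        abs_of_pos hs.1]
      exact max_lt htδ (hs.2.trans_lt htδ)
    · rw [sub_zero, abs_of_pos ht0]
  rw [dist_eq_norm, mildSol, add_sub_cancel_left]
  have : t⁻¹ • (∫ s in (0 : ℝ)..t, S (t - s) (f s)) - f 0 =
      t⁻¹ • ((∫ s in (0 : ℝ)..t, S (t - s) (f s)) - t • f 0) := by
    rw [smul_sub, inv_smul_smul₀ ht0.ne']
  rw [this, norm_smul, norm_inv, Real.norm_of_nonneg ht0.le, inv_mul_lt_iff₀ ht0]
  nlinarith

/-- The energy inequality for mild solutions. -/
theorem norm_mildSol_sq_le (hS : IsContractionSemigroup S)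
    (hc : Continuous fun p : ℝ × H => S p.1 p.2) (x : H) {f : ℝ → H} (hf : Continuous f)
    {t : ℝ} (ht : 0 ≤ t) :
    ‖mildSol S x f t‖ ^ 2 ≤ ‖x‖ ^ 2 + ∫ s in (0 : ℝ)..t, 2 * inner ℝ (f s) (mildSol S x f s) := by
  set u := mildSol S x f with hu
  have huc : Continuous u := continuous_mildSol hc x hf
  have hpc : Continuous fun s => 2 * inner ℝ (f s) (u s) := by fun_prop
  -- A mild solution need not be differentiable, so `‖u‖²` is compared with its bound through right
  -- upper slopes only.
  refine image_le_of_liminf_slope_right_le_deriv_boundary (f := fun t => ‖u t‖ ^ 2)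
    (B := fun t => ‖x‖ ^ 2 + ∫ s in (0 : ℝ)..t, 2 * inner ℝ (f s) (u s))
    (B' := fun t => 2 * inner ℝ (f t) (u t)) (a := 0) (b := t) (by fun_prop) ?_ ?_ ?_ ?_
    (right_mem_Icc.2 ht)
  · simp [hu, mildSol_zero hS]
  · exact (continuous_const.add (intervalIntegral.continuous_primitive
      (fun a b => hpc.intervalIntegrable a b) 0)).continuousOn
  · intro s _
    exact ((hpc.integral_hasStrictDerivAt 0 s).hasDerivAt.const_add _).hasDerivWithinAt
  · intro s hs r hr
    refine Eventually.frequently ?_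
    have hg : Continuous fun h => f (s + h) := by fun_prop
    have hcc : Tendsto (fun h : ℝ => h⁻¹ • (mildSol S (u s) (fun h => f (s + h)) h - S h (u s)))
        (𝓝[>] 0) (𝓝 (f s)) := by
      simpa using tendsto_mildSol_sub_semigroup_div hS hc (u s) hg
    have hlim : Tendsto (fun h : ℝ =>
        2 * inner ℝ (h⁻¹ • (mildSol S (u s) (fun h => f (s + h)) h - S h (u s))) (S h (u s)) +
        h * ‖h⁻¹ • (mildSol S (u s) (fun h => f (s + h)) h - S h (u s))‖ ^ 2) (𝓝[>] 0)
        (𝓝 (2 * inner ℝ (f s) (u s))) := by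
      have := ((hcc.inner (𝕜 := ℝ) (hS.continuous_zero (u s))).const_mul 2).add
        ((tendsto_nhdsWithin_of_tendsto_nhds tendsto_id).mul (hcc.norm.pow 2))
      simpa using this
    have hev := hlim.eventually_lt_const hr
    have hshift : Tendsto (fun τ : ℝ => τ - s) (𝓝[>] s) (𝓝[>] 0) := by
      refine tendsto_nhdsWithin_iff.2 ⟨?_, ?_⟩
      · exact tendsto_nhdsWithin_of_tendsto_nhds
          (by simpa using (continuous_sub_right s).tendsto s)
      · filter_upwards [self_mem_nhdsWithin] with τ hτ using sub_pos.2 (mem_Ioi.1 hτ)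
    filter_upwards [hshift.eventually hev, self_mem_nhdsWithin] with τ hlt hτ
    have hτ : 0 < τ - s := sub_pos.2 (mem_Ioi.1 hτ)
    refine lt_of_le_of_lt ?_ hlt
    have hrestart : u τ = mildSol S (u s) (fun h => f (s + h)) (τ - s) := by
      rw [hu, ← mildSol_add hS hc x hf hs.1 hτ.le, add_sub_cancel]
    set p := τ - s
    set w := mildSol S (u s) (fun h => f (s + h)) p
    -- Expanding around the free orbit `S p (u s)` isolates the Duhamel increment; contractivity
    -- replaces `‖S p (u s)‖` by `‖u s‖`, and dividing by `p` leaves exactly the function whose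
    -- limit is `hlim`.
    have hw : ‖w‖ ^ 2 = ‖S p (u s)‖ ^ 2 + 2 * inner ℝ (w - S p (u s)) (S p (u s)) +
        ‖w - S p (u s)‖ ^ 2 := by
      have := norm_add_sq_real (S p (u s)) (w - S p (u s))
      rw [add_sub_cancel, real_inner_comm] at this
      exact this
    have hle : ‖S p (u s)‖ ^ 2 ≤ ‖u s‖ ^ 2 := by
      gcongr; exact hS.contraction p hτ.le _
    rw [slope_def_field, hrestart, inner_smul_left, norm_smul, norm_inv,
      Real.norm_of_nonneg hτ.le]
    simp only [conj_trivial]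
    rw [div_le_iff₀ hτ, hw]
    field_simp
    linarith

end Mild

section Semilinear

variable {S : ℝ → H →L[ℝ] H} {F : H → H}

/-! ### Mild solutions of semilinear equations with dissipative nonlinearity -/

/-- `z` is a mild solution of `z' = A z + F z`, `z 0 = x` on `[0, a]`. -/
structure IsMildOn (S : ℝ → H →L[ℝ] H) (F : H → H) (x : H) (a : ℝ) (z : ℝ → H) : Prop where
  cont : Continuous z
  eq : ∀ t ∈ Icc 0 a, z t = mildSol S x (fun s => F (z s)) t

theorem IsMildOn.mono {x : H} {a b : ℝ} {z : ℝ → H} (hz : IsMildOn S F x a z) (hab : b ≤ a) :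
    IsMildOn S F x b z :=
  ⟨hz.cont, fun t ht => hz.eq t ⟨ht.1, ht.2.trans hab⟩⟩

theorem IsMildOn.init (hS : IsContractionSemigroup S) {x : H} {a : ℝ} {z : ℝ → H}
    (hz : IsMildOn S F x a z) (ha : 0 ≤ a) : z 0 = x := by
  rw [hz.eq 0 ⟨le_rfl, ha⟩, mildSol_zero hS]

theorem IsMildOn.shift (hS : IsContractionSemigroup S)
    (hc : Continuous fun p : ℝ × H => S p.1 p.2) (hF : Continuous F) {x : H} {a t : ℝ} {z : ℝ → H}
    (hz : IsMildOn S F x (t + a) z) (ht : 0 ≤ t) (ha : 0 ≤ a) :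
    IsMildOn S F (z t) a (fun s => z (t + s)) := by
  refine ⟨hz.cont.comp (continuous_const.add continuous_id), fun s hs => ?_⟩
  rw [hz.eq (t + s) ⟨add_nonneg ht hs.1, by linarith [hs.2]⟩,
    mildSol_add hS hc x (hF.comp' hz.cont) ht hs.1, ← hz.eq t ⟨ht, by linarith⟩]

theorem IsMildOn.exists_glue (hS : IsContractionSemigroup S)
    (hc : Continuous fun p : ℝ × H => S p.1 p.2) (hF : Continuous F) {x : H} {a b : ℝ}
    {z w : ℝ → H} (hz : IsMildOn S F x a z) (ha : 0 ≤ a) (hb : 0 ≤ b)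
    (hw : IsMildOn S F (z a) b w) : ∃ v, IsMildOn S F x (a + b) v := by
  let v : ℝ → H := fun t => if t ≤ a then z t else w (t - a)
  have hv : Continuous v := by
    refine Continuous.if_le hz.cont (hw.cont.comp (continuous_sub_right a)) continuous_id
      continuous_const ?_
    rintro t rfl
    simpa using (hw.init hS hb).symm
  have hv1 : ∀ t ≤ a, v t = z t := fun t ht => if_pos ht
  have hv2 : ∀ s, 0 ≤ s → v (a + s) = w s := by
    intro s hs
    rcases hs.eq_or_lt with rfl | hs
    · rw [add_zero, hv1 a le_rfl, hw.init hS hb]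
    · simp [v, not_le.2 hs]
  have hle : ∀ t ∈ Icc 0 a, v t = mildSol S x (fun s => F (v s)) t := by
    intro t ht
    rw [hv1 t ht.2, hz.eq t ht]
    exact mildSol_congr x ht.1 fun s hs => by rw [hv1 s (hs.2.trans ht.2)]
  refine ⟨v, hv, fun t ht => ?_⟩
  rcases le_total t a with hta | hta
  · exact hle t ⟨ht.1, hta⟩
  · obtain ⟨s, rfl⟩ : ∃ s, t = a + s := ⟨t - a, by ring⟩
    have hs : 0 ≤ s := by linarith
    rw [mildSol_add hS hc x (hF.comp' hv) ha hs, ← hle a ⟨ha, le_rfl⟩, hv2 s hs,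
      hw.eq s ⟨hs, by linarith [ht.2]⟩, hv1 a le_rfl]
    exact mildSol_congr _ hs fun r hr => by rw [hv2 r hr.1]

/-- Two mild solutions do not move apart. -/
theorem IsMildOn.norm_sub_le (hS : IsContractionSemigroup S)
    (hc : Continuous fun p : ℝ × H => S p.1 p.2) (hF : Continuous F)
    (hdiss : ∀ a b : H, inner ℝ (F a - F b) (a - b) ≤ 0) {x y : H} {a : ℝ} {z w : ℝ → H}
    (hz : IsMildOn S F x a z) (hw : IsMildOn S F y a w) {t : ℝ} (ht : t ∈ Icc 0 a) :
    ‖z t - w t‖ ≤ ‖x - y‖ := by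
  have heq : ∀ s ∈ Icc 0 a, z s - w s = mildSol S (x - y) (fun s => F (z s) - F (w s)) s :=
    fun s hs => by
      rw [hz.eq s hs, hw.eq s hs, mildSol_sub hc x y (hF.comp' hz.cont) (hF.comp' hw.cont)]
  have hen := norm_mildSol_sq_le hS hc (x - y) (f := fun s => F (z s) - F (w s))
    ((hF.comp' hz.cont).sub (hF.comp' hw.cont)) ht.1
  have hneg : ∫ s in (0 : ℝ)..t, 2 * inner ℝ (F (z s) - F (w s))
      (mildSol S (x - y) (fun s => F (z s) - F (w s)) s) ≤ 0 := by
    rw [← neg_nonneg, ← intervalIntegral.integral_neg]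
    refine intervalIntegral.integral_nonneg ht.1 fun s hs => ?_
    rw [← heq s ⟨hs.1, hs.2.trans ht.2⟩]
    linarith [hdiss (z s) (w s)]
  rw [← heq t ht] at hen
  exact le_of_sq_le_sq (by linarith) (norm_nonneg _)

/-- Banach's fixed point theorem for the Duhamel map. The existence time `δ` is uniform over a ball
of initial values, which is what the continuation argument needs. -/
theorem exists_isMildOn_of_locallyLipschitz (hS : IsContractionSemigroup S)
    (hc : Continuous fun p : ℝ × H => S p.1 p.2) (hF : LocallyLipschitz F) (p : H) :
    ∃ δ > 0, ∃ η > 0, ∀ q ∈ Metric.ball p η, ∃ z, IsMildOn S F q δ z := by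
  obtain ⟨K, V, hV, hK⟩ := hF p
  obtain ⟨ε, hε, hεV⟩ := Metric.nhds_basis_closedBall.mem_iff.1 hV
  replace hK := hK.mono hεV
  set M : ℝ := ‖F p‖ + K * ε with hMdef
  have hM0 : 0 ≤ M := by positivity
  have hM : ∀ v ∈ Metric.closedBall p ε, ‖F v‖ ≤ M := by
    intro v hv
    have h1 := hK.dist_le_mul v hv p (Metric.mem_closedBall_self hε.le)
    rw [dist_eq_norm] at h1
    have h2 : (K : ℝ) * dist v p ≤ K * ε := by gcongr; exact hv
    linarith [norm_le_norm_add_norm_sub' (F v) (F p)]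
  have horb : Continuous fun t => S t p := hc.comp (by fun_prop : Continuous fun t : ℝ => (t, p))
  obtain ⟨δ₁, hδ₁, h₁⟩ := Metric.continuous_iff.1 horb 0 (ε / 4) (by positivity)
  simp only [hS.zero, ContinuousLinearMap.id_apply] at h₁
  -- The three bounds keep the orbit of `p` within `ε / 4`, keep the Duhamel term within `ε / 4`,
  -- and make the contraction factor at most `1 / 2`. With `‖q - p‖ < ε / 4` the iterates stay in
  -- the `ε`-ball.
  set δ : ℝ := min (δ₁ / 2) (min (ε / (4 * (M + 1))) (1 / (2 * (K + 1)))) with hδdef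
  have hδ : 0 < δ := by positivity
  have hδM : M * δ ≤ ε / 4 := by
    have : δ ≤ ε / (4 * (M + 1)) := (min_le_right _ _).trans (min_le_left _ _)
    rw [le_div_iff₀ (by positivity)] at this
    nlinarith
  have hδK : K * δ ≤ 1 / 2 := by
    have : δ ≤ 1 / (2 * (K + 1)) := (min_le_right _ _).trans (min_le_right _ _)
    rw [le_div_iff₀ (by positivity)] at this
    nlinarith
  have hδ₁' : ∀ t ∈ Icc 0 δ, ‖S t p - p‖ ≤ ε / 4 := by
    intro t ht
    rw [← dist_eq_norm]
    refine (h₁ t ?_).le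
    rw [Real.dist_eq, sub_zero, abs_of_nonneg ht.1]
    linarith [ht.2, min_le_left (δ₁ / 2) (min (ε / (4 * (M + 1))) (1 / (2 * ((K : ℝ) + 1))))]
  refine ⟨δ, hδ, ε / 4, by positivity, fun q hq => ?_⟩
  rw [mem_ball_iff_norm] at hq
  have hext : ∀ f : C(Icc 0 δ, H), Continuous (IccExtend hδ.le f) := fun f =>
    f.continuous.Icc_extend'
  let Φ : C(Icc 0 δ, H) → C(Icc 0 δ, H) := fun f =>
    ⟨fun t => mildSol S q (fun s => F (IccExtend hδ.le f s)) t,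
      (continuous_mildSol hc q (hF.continuous.comp' (hext f))).comp continuous_subtype_val⟩
  let s : Set C(Icc 0 δ, H) := {f | ∀ t, f t ∈ Metric.closedBall p ε}
  have hs : IsComplete s := by
    refine IsClosed.isComplete ?_
    simp only [s, ofPred_forall]
    exact isClosed_iInter fun t => Metric.isClosed_closedBall.preimage (by fun_prop)
  have hmaps : MapsTo Φ s s := by
    intro f hf t
    rw [mem_closedBall_iff_norm]
    have h1 := norm_mildSol_sub_semigroup_le hS q (f := fun s => F (IccExtend hδ.le f s))
      t.2.1 (fun r _ => hM _ (hf (projIcc 0 δ hδ.le r)))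
    have h2 : ‖S t q - S t p‖ ≤ ‖q - p‖ := by
      rw [← map_sub]; exact hS.contraction _ t.2.1 _
    have h3 := hδ₁' t t.2
    have h4 : M * (t : ℝ) ≤ M * δ := by gcongr; exact t.2.2
    have : Φ f t - p = (mildSol S q (fun s => F (IccExtend hδ.le f s)) t - S t q) +
        (S t q - S t p) + (S t p - p) := by simp [Φ]
    rw [this]
    refine (norm_add₃_le).trans ?_
    linarith
  have hlip : LipschitzWith (1 / 2) (hmaps.restrict Φ s s) := by
    refine LipschitzWith.of_dist_le_mul fun f g => ?_
    rw [Subtype.dist_eq, Subtype.dist_eq]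
    simp only [MapsTo.val_restrict_apply, NNReal.coe_div, NNReal.coe_one, NNReal.coe_ofNat]
    rw [ContinuousMap.dist_le (by positivity)]
    intro t
    rw [dist_eq_norm]
    have h1 : Φ f t - Φ g t = mildSol S 0
        (fun s => F (IccExtend hδ.le f.1 s) - F (IccExtend hδ.le g.1 s)) t := by
      change mildSol _ _ _ _ - mildSol _ _ _ _ = _
      rw [mildSol_sub hc q q (hF.continuous.comp' (hext f)) (hF.continuous.comp' (hext g)), sub_self]
    have h2 := norm_mildSol_sub_semigroup_le hS 0 (M := K * dist f.1 g.1)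
      (f := fun s => F (IccExtend hδ.le f.1 s) - F (IccExtend hδ.le g.1 s)) t.2.1 (by
        intro r _
        rw [← dist_eq_norm]
        refine (hK.dist_le_mul _ (f.2 (projIcc 0 δ hδ.le r)) _ (g.2 (projIcc 0 δ hδ.le r))).trans ?_
        gcongr
        exact ContinuousMap.dist_apply_le_dist _)
    rw [map_zero, sub_zero] at h2
    rw [h1]
    refine h2.trans ?_
    have h3 : (t : ℝ) ≤ δ := t.2.2
    have h4 : (K : ℝ) * t ≤ 1 / 2 := le_trans (by gcongr) hδK
    nlinarith [dist_nonneg (x := f.1) (y := g.1)]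
  have hcontr : ContractingWith (1 / 2) (hmaps.restrict Φ s s) :=
    ⟨by rw [← NNReal.coe_lt_coe]; norm_num, hlip⟩
  obtain ⟨f, -, hfix, -⟩ := hcontr.exists_fixedPoint' hs hmaps (x := ContinuousMap.const _ p)
    (fun _ => Metric.mem_closedBall_self hε.le) (edist_ne_top _ _)
  refine ⟨IccExtend hδ.le f, hext f, fun t ht => ?_⟩
  rw [IccExtend_of_mem _ _ ht]
  exact (DFunLike.congr_fun hfix ⟨t, ht⟩).symm

/-- If the existence times had a finite supremum `m`, the nonexpansive solution map would make the
solution Cauchy as time approaches `m`; restarting near the limit would then cross `m`. -/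
theorem exists_isMildOn (hS : IsContractionSemigroup S)
    (hc : Continuous fun p : ℝ × H => S p.1 p.2) (hF : LocallyLipschitz F)
    (hdiss : ∀ a b : H, inner ℝ (F a - F b) (a - b) ≤ 0) (x : H) (a : ℝ) :
    ∃ z, IsMildOn S F x a z := by
  by_contra hcon
  let J : Set ℝ := {b | 0 ≤ b ∧ ∃ z, IsMildOn S F x b z}
  have hJa : ∀ b ∈ J, b ≤ a := by
    rintro b ⟨-, z, hz⟩
    by_contra hlt
    exact hcon ⟨z, hz.mono (not_le.1 hlt).le⟩
  have hJb : BddAbove J := ⟨a, hJa⟩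
  have h0 : ∃ d > 0, d ∈ J := by
    obtain ⟨δ, hδ, η, hη, h⟩ := exists_isMildOn_of_locallyLipschitz hS hc hF x
    exact ⟨δ, hδ, hδ.le, h x (Metric.mem_ball_self hη)⟩
  set m := sSup J with hm
  have hm0 : 0 < m := by
    obtain ⟨d, hd, hdJ⟩ := h0
    exact hd.trans_le (le_csSup hJb hdJ)
  have hex : ∀ b, 0 ≤ b → b < m → ∃ z, IsMildOn S F x b z := by
    intro b _ hbm
    obtain ⟨c, ⟨-, z, hz⟩, hbc⟩ := exists_lt_of_lt_csSup ⟨_, h0.choose_spec.2⟩ hbm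
    exact ⟨z, hz.mono hbc.le⟩
  obtain ⟨u, -, hu_lt, hu_lim⟩ := exists_seq_strictMono_tendsto' hm0
  choose z hz using fun n => hex (u n) (hu_lt n).1.le (hu_lt n).2
  obtain ⟨d, hd, -, w, hw⟩ := h0
  -- For `u i ≤ u j`, the values at times `u j` and `u i` arise by evolving `z j (u j - u i)` and
  -- `x` for the same time `u i`. Their distance is therefore at most that of the initial data,
  -- which is small by continuity at `0` of the fixed local solution `w`.
  have hcauchy : CauchySeq fun n => z n (u n) := by
    rw [Metric.cauchySeq_iff]
    intro ε hε
    obtain ⟨δ, hδ, hwδ⟩ := Metric.continuous_iff.1 hw.cont 0 ε hε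
    rw [hw.init hS hd.le] at hwδ
    obtain ⟨N, hN⟩ := Metric.cauchySeq_iff.1 hu_lim.cauchySeq (min δ d) (lt_min hδ hd)
    have key : ∀ i ≥ N, ∀ j ≥ N, u i ≤ u j → dist (z i (u i)) (z j (u j)) < ε := by
      intro i hi j hj hij
      have hlt := hN j hj i hi
      rw [Real.dist_eq, abs_of_nonneg (sub_nonneg.2 hij)] at hlt
      have hpos := sub_nonneg.2 hij
      have hmem : u i ∈ Icc 0 (u i) := ⟨(hu_lt i).1.le, le_rfl⟩
      have h1 : z i (u i) = z j (u i) := by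
        have := (hz i).norm_sub_le hS hc hF.continuous hdiss ((hz j).mono hij) hmem
        rw [sub_self, norm_zero] at this
        exact sub_eq_zero.1 (norm_le_zero_iff.1 this)
      have hdist : u j - u i < d := hlt.trans_le (min_le_right _ _)
      have h2 : z j (u j - u i) = w (u j - u i) := by
        have hzj := (hz j).mono (b := u j - u i) (by linarith [(hu_lt i).1])
        have := hzj.norm_sub_le hS hc hF.continuous hdiss (hw.mono hdist.le) ⟨hpos, le_rfl⟩
        rw [sub_self, norm_zero] at this
        exact sub_eq_zero.1 (norm_le_zero_iff.1 this)
      have hsh := ((hz j).mono (b := (u j - u i) + u i) (by linarith)).shift hS hc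
        hF.continuous hpos (hu_lt i).1.le
      have h3 := hsh.norm_sub_le hS hc hF.continuous hdiss ((hz j).mono hij) hmem
      rw [sub_add_cancel, h2] at h3
      rw [h1, dist_comm, dist_eq_norm]
      refine h3.trans_lt ?_
      rw [← dist_eq_norm]
      refine hwδ _ ?_
      rw [Real.dist_eq, sub_zero, abs_of_nonneg hpos]
      exact hlt.trans_le (min_le_left _ _)
    refine ⟨N, fun i hi j hj => ?_⟩
    rcases le_total (u i) (u j) with hij | hij
    · exact key i hi j hj hij
    · rw [dist_comm]; exact key j hj i hi hij
  obtain ⟨p, hp⟩ := cauchySeq_tendsto_of_complete hcauchy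
  -- Some `u n > m - δ` has its state in the ball where the existence time is at least `δ`, so
  -- gluing gives a solution beyond `m`.
  obtain ⟨δ, hδ, η, hη, hloc⟩ := exists_isMildOn_of_locallyLipschitz hS hc hF p
  obtain ⟨n, hn1, hn2⟩ := ((hp.eventually (Metric.ball_mem_nhds p hη)).and
    (hu_lim.eventually (lt_mem_nhds (sub_lt_self m hδ)))).exists
  obtain ⟨v, hv⟩ := hloc _ hn1
  have hn0 := (hu_lt n).1.le
  have := le_csSup hJb ⟨add_nonneg hn0 hδ.le,
    (hz n).exists_glue hS hc hF.continuous hn0 hδ.le hv⟩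
  linarith

/-- Global existence of mild solutions. -/
theorem exists_forall_isMildOn (hS : IsContractionSemigroup S)
    (hc : Continuous fun p : ℝ × H => S p.1 p.2) (hF : LocallyLipschitz F)
    (hdiss : ∀ a b : H, inner ℝ (F a - F b) (a - b) ≤ 0) (x : H) :
    ∃ z, ∀ a, IsMildOn S F x a z := by
  choose z hz using fun n : ℕ => exists_isMildOn hS hc hF hdiss x n
  have huniq : ∀ (m n : ℕ) (t : ℝ), 0 ≤ t → t ≤ m → t ≤ n → z m t = z n t := by
    intro m n t h0 hm hn
    have := ((hz m).mono hm).norm_sub_le hS hc hF.continuous hdiss ((hz n).mono hn) ⟨h0, le_rfl⟩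
    rw [sub_self, norm_zero] at this
    exact sub_eq_zero.1 (norm_le_zero_iff.1 this)
  let v : ℝ → H := fun t => z ⌈max t 0⌉₊ (max t 0)
  have hv : ∀ (n : ℕ) (t : ℝ), t ≤ n → v t = z n (max t 0) := fun n t ht =>
    huniq _ _ _ (le_max_right _ _) (Nat.le_ceil _) (max_le ht n.cast_nonneg)
  have hvc : Continuous v := by
    rw [continuous_iff_continuousAt]
    intro t
    obtain ⟨n, hn⟩ := exists_nat_gt t
    have h1 : ContinuousAt (fun t => z n (max t 0)) t :=
      ((hz n).cont.comp (continuous_id.max continuous_const)).continuousAt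
    refine h1.congr ?_
    filter_upwards [eventually_lt_nhds hn] with s hs using (hv n s hs.le).symm
  refine ⟨v, fun a => ⟨hvc, fun t ht => ?_⟩⟩
  obtain ⟨n, hn⟩ := exists_nat_ge t
  rw [hv n t hn, max_eq_left ht.1, (hz n).eq t ⟨ht.1, hn⟩]
  exact mildSol_congr x ht.1 fun s hs => by rw [hv n s (hs.2.trans hn), max_eq_left hs.1]

end Semilinear

section Regularity

variable {S : ℝ → H →L[ℝ] H} {F : H → H} {A : H →ₗ.[ℝ] H}

/-! ### The domain of the generator and strong solutions -/

theorem hasDerivWithinAt_Ioi_of_tendsto {f : ℝ → H} {f' : H} {t : ℝ}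
    (h : Tendsto (fun h : ℝ => h⁻¹ • (f (t + h) - f t)) (𝓝[>] 0) (𝓝 f')) :
    HasDerivWithinAt f f' (Ioi t) t := by
  rw [hasDerivWithinAt_iff_tendsto_slope' (by simp)]
  have hshift : Tendsto (fun τ : ℝ => τ - t) (𝓝[>] t) (𝓝[>] 0) := by
    refine tendsto_nhdsWithin_iff.2 ⟨?_, ?_⟩
    · exact tendsto_nhdsWithin_of_tendsto_nhds
        (by simpa using (continuous_sub_right t).tendsto t)
    · filter_upwards [self_mem_nhdsWithin] with τ hτ using sub_pos.2 (mem_Ioi.1 hτ)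
  refine (h.comp hshift).congr fun τ => ?_
  simp [slope]

theorem continuous_orbit (hc : Continuous fun p : ℝ × H => S p.1 p.2) (x : H) :
    Continuous fun t => S t x :=
  hc.comp (by fun_prop : Continuous fun t : ℝ => (t, x))

theorem IsGenerator.hasDerivWithinAt (hL : IsGenerator A S) (hS : IsContractionSemigroup S)
    {x y : H} (hxy : (x, y) ∈ A.graph) {t : ℝ} (ht : 0 ≤ t) :
    HasDerivWithinAt (fun s => S s x) (S t y) (Ioi t) t := by
  refine hasDerivWithinAt_Ioi_of_tendsto ?_
  refine (((S t).continuous.tendsto y).comp ((hL x y).1 hxy)).congr' ?_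
  filter_upwards [self_mem_nhdsWithin] with h hh
  simp [hS.add t h ht (mem_Ioi.1 hh).le]

theorem IsGenerator.norm_sub_le (hL : IsGenerator A S) (hS : IsContractionSemigroup S)
    (hc : Continuous fun p : ℝ × H => S p.1 p.2) {x y : H} (hxy : (x, y) ∈ A.graph) {t : ℝ}
    (ht : 0 ≤ t) : ‖S t x - x‖ ≤ ‖y‖ * t := by
  have := norm_image_sub_le_of_norm_deriv_right_le_segment (f := fun s => S s x) (a := 0) (b := t)
    (continuous_orbit hc x).continuousOn
    (fun s hs => (hL.hasDerivWithinAt hS hxy hs.1).Ici_of_Ioi)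
    (fun s hs => hS.contraction s hs.1 y) t (right_mem_Icc.2 ht)
  simpa [hS.zero] using this

/-- Contractivity gives `⟨S h x, x⟩ ≤ ‖x‖²`, with equality at `h = 0`; this is the sign of the right
derivative there. -/
theorem IsGenerator.inner_nonpos (hL : IsGenerator A S) (hS : IsContractionSemigroup S)
    {x y : H} (hxy : (x, y) ∈ A.graph) : inner ℝ y x ≤ 0 := by
  refine le_of_tendsto (((hL x y).1 hxy).inner (𝕜 := ℝ) tendsto_const_nhds) ?_
  filter_upwards [self_mem_nhdsWithin] with h hh
  have hh : 0 < h := hh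
  rw [inner_smul_left, inner_sub_left, real_inner_self_eq_norm_sq]
  have h1 := real_inner_le_norm (S h x) x
  have h2 : ‖S h x‖ * ‖x‖ ≤ ‖x‖ * ‖x‖ := by gcongr; exact hS.contraction h hh.le x
  exact mul_nonpos_of_nonneg_of_nonpos (by simpa using hh.le) (by nlinarith)

/-- The operator `v ↦ ∫₀ᵗ S s v ds`. -/
def integralSemigroup (hS : IsContractionSemigroup S)
    (hc : Continuous fun p : ℝ × H => S p.1 p.2) {t : ℝ} (ht : 0 ≤ t) : H →L[ℝ] H :=
  LinearMap.mkContinuous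
    { toFun := fun v => ∫ s in (0 : ℝ)..t, S s v
      map_add' := fun v w => by
        simp only [map_add]
        exact intervalIntegral.integral_add ((continuous_orbit hc v).intervalIntegrable _ _)
          ((continuous_orbit hc w).intervalIntegrable _ _)
      map_smul' := fun r v => by simp } t fun v => by
    refine (intervalIntegral.norm_integral_le_of_norm_le_const (C := ‖v‖) fun s hs => ?_).trans ?_
    · rw [uIoc_of_le ht] at hs
      exact hS.contraction s hs.1.le v
    · rw [sub_zero, abs_of_nonneg ht, mul_comm]

theorem integralSemigroup_apply (hS : IsContractionSemigroup S)
    (hc : Continuous fun p : ℝ × H => S p.1 p.2) {t : ℝ} (ht : 0 ≤ t) (v : H) :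
    integralSemigroup hS hc ht v = ∫ s in (0 : ℝ)..t, S s v := rfl

/-- By the semigroup law, integrating `S h x` shifts the interval by `h`. The quotient becomes the
difference of the orbit averages over `[t, t + h]` and `[0, h]`, so it converges for every `x`, in
the domain or not. -/
theorem tendsto_integralSemigroup_quotient (hS : IsContractionSemigroup S)
    (hc : Continuous fun p : ℝ × H => S p.1 p.2) {t : ℝ} (ht : 0 ≤ t) (x : H) :
    Tendsto (fun h : ℝ => integralSemigroup hS hc ht (h⁻¹ • (S h x - x))) (𝓝[>] 0)
      (𝓝 (S t x - x)) := by
  have hco := continuous_orbit hc x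
  have hi := fun a b : ℝ => hco.intervalIntegrable (μ := volume) a b
  have hd := fun r : ℝ => (hco.integral_hasStrictDerivAt 0 r).hasDerivAt.tendsto_slope_zero_right
  have h0 := hd 0
  simp only [hS.zero, ContinuousLinearMap.id_apply] at h0
  refine ((hd t).sub h0).congr' ?_
  filter_upwards [self_mem_nhdsWithin] with h hh
  have hh : 0 < h := hh
  have h1 : integralSemigroup hS hc ht (S h x) = ∫ s in h..(t + h), S s x := by
    rw [integralSemigroup_apply]
    have := intervalIntegral.integral_comp_add_right (a := 0) (b := t) (fun s => S s x) h
    rw [zero_add] at this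
    rw [← this]
    refine intervalIntegral.integral_congr fun s hs => ?_
    rw [uIcc_of_le ht] at hs
    simp only [hS.add s h hs.1 hh.le]
    rfl
  rw [map_smul, map_sub, h1, integralSemigroup_apply, ← smul_sub,
    ← intervalIntegral.integral_interval_sub_left (hi 0 (t + h)) (hi 0 h)]
  simp only [intervalIntegral.integral_same, zero_add, sub_zero]
  congr 1
  abel

/-- A vector with bounded difference quotients lies in the domain of the generator. -/
theorem IsGenerator.exists_mem_graph (hL : IsGenerator A S) (hS : IsContractionSemigroup S)
    (hc : Continuous fun p : ℝ × H => S p.1 p.2) {x : H} {M : ℝ}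
    (hx : ∀ h > 0, ‖S h x - x‖ ≤ M * h) : ∃ y, (x, y) ∈ A.graph ∧ ‖y‖ ≤ M := by
  have hq : ∀ h > 0, ‖h⁻¹ • (S h x - x)‖ ≤ M := by
    intro h hh
    rw [norm_smul, norm_inv, Real.norm_of_nonneg hh.le, inv_mul_le_iff₀ hh, mul_comm]
    exact hx h hh
  -- Banach–Alaoglu: along an ultrafilter refining `h ↓ 0` the bounded quotients have a weak limit
  -- `w`, the candidate for the value of the generator at `x`.
  let 𝒰 : Ultrafilter ℝ := Ultrafilter.of (𝓝[>] 0)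
  have h𝒰 : (𝒰 : Filter ℝ) ≤ 𝓝[>] 0 := Ultrafilter.of_le _
  let φ : ℝ → WeakDual ℝ H := fun h =>
    StrongDual.toWeakDual (InnerProductSpace.toDual ℝ H (h⁻¹ • (S h x - x)))
  obtain ⟨ψ, hψ, hlim⟩ := (WeakDual.isCompact_closedBall (0 : StrongDual ℝ H) M).ultrafilter_le_nhds'
    (𝒰.map φ) (by
      change ∀ᶠ h in (𝒰 : Filter ℝ), φ h ∈ _
      refine h𝒰 ?_
      filter_upwards [self_mem_nhdsWithin] with h hh
      rw [mem_preimage, mem_closedBall_zero_iff]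
      exact ((InnerProductSpace.toDual ℝ H).norm_map _).trans_le (hq h hh))
  let w : H := (InnerProductSpace.toDual ℝ H).symm (WeakDual.toStrongDual ψ)
  have hw : ‖w‖ ≤ M := by
    rw [mem_preimage, mem_closedBall_zero_iff] at hψ
    simpa [w] using hψ
  have hweak : ∀ y : H, Tendsto (fun h : ℝ => inner ℝ (h⁻¹ • (S h x - x)) y) 𝒰
      (𝓝 (inner ℝ w y)) := by
    intro y
    have h1 : Tendsto φ 𝒰 (𝓝 ψ) := hlim
    have h2 := ((WeakDual.eval_continuous y).tendsto ψ).comp h1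
    have h3 : inner ℝ w y = ψ y := by
      simp [w]
    rw [h3]
    exact h2
  -- The adjoint of the integral operator carries the weak limit through it, and
  -- `tendsto_integralSemigroup_quotient` identifies the result.
  have hint : ∀ t, ∀ ht : 0 ≤ t, integralSemigroup hS hc ht w = S t x - x := by
    intro t ht
    refine ext_inner_right ℝ fun y => ?_
    have h1 := (tendsto_integralSemigroup_quotient hS hc ht x).mono_left h𝒰 |>.inner (𝕜 := ℝ)
      (tendsto_const_nhds (x := y))
    have h2 := hweak (ContinuousLinearMap.adjoint (integralSemigroup hS hc ht) y)
    simp only [ContinuousLinearMap.adjoint_inner_right] at h2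
    exact tendsto_nhds_unique h2 h1
  -- Since `S h x - x = ∫₀ʰ S s w ds` has a continuous integrand, the quotients converge to `w` in
  -- norm.
  refine ⟨w, (hL x w).2 ?_, hw⟩
  have hd := ((continuous_orbit hc w).integral_hasStrictDerivAt 0
    0).hasDerivAt.tendsto_slope_zero_right
  simp only [hS.zero, ContinuousLinearMap.id_apply, intervalIntegral.integral_same, zero_add,
    sub_zero] at hd
  refine hd.congr' ?_
  filter_upwards [self_mem_nhdsWithin] with h hh
  rw [← hint h (mem_Ioi.1 hh).le, integralSemigroup_apply]

/-- Mild solutions starting in the domain are Lipschitz. -/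
theorem IsMildOn.norm_sub_le_mul (hL : IsGenerator A S) (hS : IsContractionSemigroup S)
    (hc : Continuous fun p : ℝ × H => S p.1 p.2) (hF : Continuous F)
    (hdiss : ∀ a b : H, inner ℝ (F a - F b) (a - b) ≤ 0) {x y : H} (hxy : (x, y) ∈ A.graph)
    {z : ℝ → H} (hz : ∀ a, IsMildOn S F x a z) {M : ℝ} (hM : ∀ t, 0 ≤ t → ‖F (z t)‖ ≤ M)
    {s t : ℝ} (hs : 0 ≤ s) (hst : s ≤ t) : ‖z t - z s‖ ≤ (‖y‖ + M) * (t - s) := by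
  have hpos := sub_nonneg.2 hst
  -- The solution is compared with its own shift by `t - s`: `‖z t - z s‖ ≤ ‖z (t - s) - x‖`, and
  -- near time `0` the orbit and the Duhamel term are bounded explicitly.
  have h1 := ((hz _).shift hS hc hF hpos hs).norm_sub_le hS hc hF hdiss (hz s) ⟨hs, le_rfl⟩
  rw [sub_add_cancel] at h1
  refine h1.trans ?_
  rw [(hz (t - s)).eq (t - s) ⟨hpos, le_rfl⟩]
  have h2 := norm_mildSol_sub_semigroup_le hS x (f := fun s => F (z s)) hpos
    (fun r hr => hM r hr.1)
  have h3 := hL.norm_sub_le hS hc hxy hpos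
  linarith [norm_sub_le_norm_sub_add_norm_sub (mildSol S x (fun s => F (z s)) (t - s))
    (S (t - s) x) x]

/-- Over a step `h` the free orbit from `z t` stays within `M h` of `z (t + h)`, and `z` is
Lipschitz, so the difference quotients at `z t` are bounded by `‖y‖ + 2 M`. -/
theorem IsMildOn.exists_mem_graph (hL : IsGenerator A S) (hS : IsContractionSemigroup S)
    (hc : Continuous fun p : ℝ × H => S p.1 p.2) (hF : Continuous F)
    (hdiss : ∀ a b : H, inner ℝ (F a - F b) (a - b) ≤ 0) {x y : H} (hxy : (x, y) ∈ A.graph)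
    {z : ℝ → H} (hz : ∀ a, IsMildOn S F x a z) {M : ℝ} (hM : ∀ t, 0 ≤ t → ‖F (z t)‖ ≤ M)
    {t : ℝ} (ht : 0 ≤ t) : ∃ v, (z t, v) ∈ A.graph ∧ ‖v‖ ≤ ‖y‖ + 2 * M := by
  refine hL.exists_mem_graph hS hc fun h hh => ?_
  have h1 := IsMildOn.norm_sub_le_mul hL hS hc hF hdiss hxy hz hM ht (le_add_of_nonneg_right hh.le)
  have h2 := norm_mildSol_sub_semigroup_le hS (z t) (f := fun s => F (z (t + s))) hh.le
    (fun r hr => hM (t + r) (add_nonneg ht hr.1))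
  rw [← ((hz (t + h)).shift hS hc hF ht hh.le).eq h ⟨hh.le, le_rfl⟩] at h2
  rw [norm_sub_rev] at h2
  have h3 := norm_sub_le_norm_sub_add_norm_sub (S h (z t)) (z (t + h)) (z t)
  nlinarith

theorem IsMildOn.hasDerivWithinAt (hL : IsGenerator A S) (hS : IsContractionSemigroup S)
    (hc : Continuous fun p : ℝ × H => S p.1 p.2) (hF : Continuous F) {x : H} {z : ℝ → H}
    (hz : ∀ a, IsMildOn S F x a z) {t : ℝ} (ht : 0 ≤ t) {v : H} (hv : (z t, v) ∈ A.graph) :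
    HasDerivWithinAt z (v + F (z t)) (Ioi t) t := by
  refine hasDerivWithinAt_Ioi_of_tendsto ?_
  have hg : Continuous fun s => F (z (t + s)) :=
    hF.comp' ((hz 0).cont.comp' (continuous_const.add continuous_id))
  have h1 := tendsto_mildSol_sub_semigroup_div hS hc (z t) hg
  simp only [add_zero] at h1
  refine (((hL _ _).1 hv).add h1).congr' ?_
  filter_upwards [self_mem_nhdsWithin] with h hh
  have hh : 0 < h := hh
  rw [← ((hz (t + h)).shift hS hc hF ht hh.le).eq h ⟨hh.le, le_rfl⟩, ← smul_add]
  congr 1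
  abel

/-- Mild solutions starting in the domain are differentiable almost everywhere. -/
theorem IsMildOn.ae_hasDerivAt (hL : IsGenerator A S) (hS : IsContractionSemigroup S)
    (hc : Continuous fun p : ℝ × H => S p.1 p.2) (hF : Continuous F) {x : H}
    {z g : ℝ → H} (hz : ∀ a, IsMildOn S F x a z) {M C : ℝ} (hM : ∀ t, 0 ≤ t → ‖F (z t)‖ ≤ M)
    (hg : ∀ t, 0 ≤ t → (z t, g t) ∈ A.graph) (hgC : ∀ t, 0 ≤ t → ‖g t‖ ≤ C) :
    ∀ᵐ t : ℝ, 0 < t → HasDerivAt z (g t + F (z t)) t := by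
  have hzc : Continuous z := (hz 0).cont
  have hmc : Continuous fun t : ℝ => z (max t 0) :=
    hzc.comp' (continuous_id.max continuous_const)
  -- The generator is unbounded, so measurability of `g` comes from writing it as a pointwise limit
  -- of continuous difference quotients.
  have hmeas : StronglyMeasurable fun t => g (max t 0) := by
    refine stronglyMeasurable_of_tendsto atTop (f := fun (n : ℕ) t =>
      ((1 / ((n : ℝ) + 1))⁻¹ • (S (1 / ((n : ℝ) + 1)) (z (max t 0)) - z (max t 0)))) ?_ ?_
    · intro n
      exact Continuous.stronglyMeasurable (by fun_prop)
    · rw [tendsto_pi_nhds]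
      intro t
      have h1 := (hL _ _).1 (hg (max t 0) (le_max_right _ _))
      refine h1.comp (tendsto_nhdsWithin_iff.2 ⟨tendsto_one_div_add_atTop_nhds_zero_nat, ?_⟩)
      exact Eventually.of_forall fun n => mem_Ioi.2 (by positivity)
  let G : ℝ → H := fun t => g (max t 0) + F (z (max t 0))
  have hG : LocallyIntegrable G volume := by
    refine (locallyIntegrable_const (C + M)).mono
      (hmeas.add (hF.comp' hmc).stronglyMeasurable).aestronglyMeasurable
      (Eventually.of_forall fun t => ?_)
    have h0 := le_max_right t 0
    exact ((norm_add_le _ _).trans (add_le_add (hgC _ h0) (hM _ h0))).trans (le_abs_self _)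
  -- Right differentiability everywhere already makes `z` the integral of `G`; Lebesgue
  -- differentiation then gives two-sided derivatives almost everywhere.
  have hint : ∀ t, 0 ≤ t → ∫ s in (0 : ℝ)..t, G s = z t - z 0 := by
    intro t ht
    refine intervalIntegral.integral_eq_sub_of_hasDeriv_right_of_le ht hzc.continuousOn
      (fun s hs => ?_) (hG.integrableOn_isCompact isCompact_uIcc).intervalIntegrable
    have hs0 : max s 0 = s := max_eq_left hs.1.le
    simp only [G, hs0]
    exact IsMildOn.hasDerivWithinAt hL hS hc hF hz hs.1.le (hg s hs.1.le)
  filter_upwards [_root_.LocallyIntegrable.ae_hasDerivAt_integral hG] with t ht ht0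
  have h1 := (ht 0).add_const (z 0)
  simp only [G, max_eq_left ht0.le] at h1
  refine h1.congr_of_eventuallyEq ?_
  filter_upwards [eventually_gt_nhds ht0] with s hs
  have := hint s hs.le
  simp only [G] at this
  rw [this, sub_add_cancel]

end Regularity

section Uniqueness

variable {S : ℝ → H →L[ℝ] H} {F : H → H} {A : H →ₗ.[ℝ] H}

/-! ### Uniqueness of strong solutions -/

theorem absolutelyContinuousOnInterval_norm {f : ℝ → H} {a b : ℝ}
    (hf : AbsolutelyContinuousOnInterval f a b) :
    AbsolutelyContinuousOnInterval (fun t => ‖f t‖) a b := by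
  refine squeeze_zero (fun _ => Finset.sum_nonneg fun _ _ => dist_nonneg) (fun t => ?_) hf
  exact Finset.sum_le_sum fun _ _ => (dist_norm_norm_le _ _).trans_eq (dist_eq_norm _ _).symm

/-- The derivative of `‖w - z‖²` is nonpositive almost everywhere, and absolute continuity allows it
to be integrated from the common initial value. -/
theorem IsStrongSolution.eq_of_dissipative {D : Submodule ℝ H} {G : D → H}
    (hG : ∀ a b : D, inner ℝ (G a - G b) ((a : H) - b) ≤ 0) {z₀ : D} {z w : ℝ → H}
    (hz : IsStrongSolution G z₀ z) (hw : IsStrongSolution G z₀ w) {t : ℝ} (ht : 0 ≤ t) :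
    w t = z t := by
  rcases ht.eq_or_lt with rfl | ht0
  · rw [hz.init, hw.init]
  have hac : AbsolutelyContinuousOnInterval (fun s => ‖w s - z s‖ * ‖w s - z s‖) 0 t := by
    have := absolutelyContinuousOnInterval_norm
      ((hw.absolutelyContinuous t ht0).fun_sub (hz.absolutelyContinuous t ht0))
    exact this.fun_mul this
  have hint := hac.integral_deriv_eq_sub
  have hle : 0 ≤ ∫ s in (0 : ℝ)..t, -deriv (fun s => ‖w s - z s‖ * ‖w s - z s‖) s := by
    refine intervalIntegral.integral_nonneg_of_ae_restrict ht ?_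
    refine (ae_restrict_iff' measurableSet_Icc).2 ?_
    filter_upwards [hz.eqn, hw.eqn, Measure.ae_ne volume (0 : ℝ)] with s hzs hws hs0 hs
    have hs0 : 0 < s := lt_of_le_of_ne hs.1 (Ne.symm hs0)
    have hd := (((hws hs0).sub (hzs hs0)).norm_sq)
    simp only [pow_two] at hd
    have hd' : HasDerivAt (fun s => ‖w s - z s‖ * ‖w s - z s‖) _ s := hd
    rw [Pi.zero_apply, hd'.deriv]
    have := hG ⟨w s, hw.mem s hs0.le⟩ ⟨z s, hz.mem s hs0.le⟩
    rw [real_inner_comm] at this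
    simp only [Pi.sub_apply]
    linarith
  rw [intervalIntegral.integral_neg, hint, hz.init, hw.init, sub_self, norm_zero] at hle
  have h0 : ‖w t - z t‖ * ‖w t - z t‖ = 0 :=
    le_antisymm (by linarith) (mul_self_nonneg _)
  exact sub_eq_zero.1 (norm_eq_zero.1 (mul_self_eq_zero.1 h0))

/-! ### Bounded dissipative perturbations of a generator -/

theorem IsMildOn.unique (hS : IsContractionSemigroup S)
    (hc : Continuous fun p : ℝ × H => S p.1 p.2) (hF : Continuous F)
    (hdiss : ∀ a b : H, inner ℝ (F a - F b) (a - b) ≤ 0) {x : H} {a : ℝ} {z w : ℝ → H}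
    (hz : IsMildOn S F x a z) (hw : IsMildOn S F x a w) {t : ℝ} (ht : t ∈ Icc 0 a) :
    z t = w t := by
  have := hz.norm_sub_le hS hc hF hdiss hw ht
  rw [sub_self, norm_zero] at this
  exact sub_eq_zero.1 (norm_le_zero_iff.1 this)

theorem IsMildOn.add (hc : Continuous fun p : ℝ × H => S p.1 p.2) {G : H →L[ℝ] H} {x y : H}
    {a : ℝ} {z w : ℝ → H} (hz : IsMildOn S G x a z) (hw : IsMildOn S G y a w) :
    IsMildOn S G (x + y) a fun t => z t + w t := by
  refine ⟨hz.cont.add hw.cont, fun t ht => ?_⟩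
  rw [hz.eq t ht, hw.eq t ht]
  unfold mildSol
  simp only [map_add]
  rw [intervalIntegral.integral_add
    ((continuous_semigroup_comp hc (G.continuous.comp' hz.cont) t).intervalIntegrable _ _)
    ((continuous_semigroup_comp hc (G.continuous.comp' hw.cont) t).intervalIntegrable _ _)]
  abel

theorem IsMildOn.const_smul {G : H →L[ℝ] H} {x : H} {a : ℝ} {z : ℝ → H} (c : ℝ)
    (hz : IsMildOn S G x a z) : IsMildOn S G (c • x) a fun t => c • z t := by
  refine ⟨hz.cont.const_smul c, fun t ht => ?_⟩
  rw [hz.eq t ht]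
  simp [mildSol, map_smul]

theorem isMildOn_zero (hF0 : F 0 = 0) (a : ℝ) : IsMildOn S F 0 a fun _ => 0 :=
  ⟨continuous_const, fun t _ => by simp [mildSol, hF0]⟩

/-- A bounded dissipative perturbation of the generator of a contraction semigroup generates a
contraction semigroup, whose orbits are the mild solutions of the perturbed equation. -/
theorem exists_perturbed_semigroup (hL : IsGenerator A S) (hS : IsContractionSemigroup S)
    (hc : Continuous fun p : ℝ × H => S p.1 p.2) (G : H →L[ℝ] H)
    (hG : ∀ a : H, inner ℝ (G a) a ≤ 0) {L : H →ₗ.[ℝ] H}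
    (hLG : ∀ x y : H, (x, y) ∈ L.graph ↔ (x, y - G x) ∈ A.graph) :
    ∃ T : ℝ → H →L[ℝ] H, IsContractionSemigroup T ∧ IsGenerator L T ∧
      ∀ x a, IsMildOn S G x a fun t => T t x := by
  have hdiss : ∀ a b : H, inner ℝ (G a - G b) (a - b) ≤ 0 := fun a b => by
    rw [← map_sub]; exact hG _
  choose z hz using exists_forall_isMildOn hS hc G.lipschitz.locallyLipschitz hdiss
  have huniq : ∀ {x : H} {w : ℝ → H}, (∀ a, IsMildOn S G x a w) → ∀ t, 0 ≤ t → z x t = w t :=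
    fun hw t ht => (hz _ t).unique hS hc G.continuous hdiss (hw t) ⟨ht, le_rfl⟩
  have hnorm : ∀ x t, 0 ≤ t → ‖z x t‖ ≤ ‖x‖ := fun x t ht => by
    simpa using (hz x t).norm_sub_le hS hc G.continuous hdiss (isMildOn_zero (map_zero G) t)
      ⟨ht, le_rfl⟩
  -- Linearity in the initial value follows from uniqueness of mild solutions.
  let T : ℝ → H →L[ℝ] H := fun t => LinearMap.mkContinuous
    { toFun := fun x => z x (max t 0)
      map_add' := fun x y =>
        huniq (fun a => (hz x a).add hc (hz y a)) _ (le_max_right _ _)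
      map_smul' := fun c x => huniq (fun a => (hz x a).const_smul c) _ (le_max_right _ _) } 1
    fun x => by simpa using hnorm x _ (le_max_right _ _)
  have hT : ∀ t x, 0 ≤ t → T t x = z x t := fun t x ht => by
    change z x (max t 0) = z x t
    rw [max_eq_left ht]
  have hinit : ∀ x, z x 0 = x := fun x => (hz x 0).init hS le_rfl
  have hTm : ∀ x a, IsMildOn S G x a fun t => T t x := fun x a =>
    ⟨(hz x a).cont.comp' (continuous_id.max continuous_const), fun t ht => by
      rw [hT t x ht.1, (hz x a).eq t ht]
      exact mildSol_congr x ht.1 fun s hs => by rw [hT s x hs.1]⟩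
  refine ⟨T, ⟨?_, ?_, ?_, ?_⟩, ?_, hTm⟩
  · ext x
    rw [hT 0 x le_rfl, hinit]
    rfl
  · intro s t hs ht
    ext x
    rw [ContinuousLinearMap.comp_apply, hT _ _ hs, hT _ _ (add_nonneg hs ht), hT _ _ ht, add_comm]
    exact ((hz x (t + s)).shift hS hc G.continuous ht hs).unique hS hc G.continuous hdiss
      (hz (z x t) s) ⟨hs, le_rfl⟩
  · intro x
    have h1 := ((hTm x 0).cont.tendsto 0).mono_left (nhdsWithin_le_nhds (s := Ioi 0))
    rwa [hT 0 x le_rfl, hinit] at h1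
  · intro t ht x
    rw [hT t x ht]
    exact hnorm x t ht
  · intro x y
    rw [hLG x y, hL x (y - G x)]
    have h1 := tendsto_mildSol_sub_semigroup_div hS hc x (G.continuous.comp' (hTm x 0).cont)
    rw [hT 0 x le_rfl, hinit] at h1
    -- The quotients of `T` and `S` differ by a Duhamel quotient that converges to `G x` for every
    -- `x`, so one converges exactly when the other does.
    have h2 : ∀ᶠ h : ℝ in 𝓝[>] 0, h⁻¹ • (T h x - x) = h⁻¹ • (S h x - x) +
        h⁻¹ • (mildSol S x (fun s => G (T s x)) h - S h x) := by
      filter_upwards [self_mem_nhdsWithin] with h hh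
      rw [← (hTm x h).eq h ⟨(mem_Ioi.1 hh).le, le_rfl⟩, ← smul_add]
      congr 1
      abel
    constructor
    · intro h
      have := h.add h1
      rw [sub_add_cancel] at this
      exact this.congr' (h2.mono fun _ h => h.symm)
    · intro h
      refine (h.sub h1).congr' ?_
      filter_upwards [h2] with h hh
      rw [hh, add_sub_cancel_right]

end Uniqueness

section Damping

variable {S : ℝ → H →L[ℝ] H} {A : H →ₗ.[ℝ] H} {B : U →L[ℝ] H} {k : ℝ} {σ : U → U}

/-! ### Nonlinear damping -/

/-- The bounded part `-√k B σ(√k B⋆ z)` of the nonlinear closed-loop operator. -/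
def feedback (B : U →L[ℝ] H) (k : ℝ) (σ : U → U) (z : H) : H :=
  -(√k • B (σ (√k • ContinuousLinearMap.adjoint B z)))

/-- The bounded part `-k B B⋆` of the linear closed-loop operator. -/
def linearFeedback (B : U →L[ℝ] H) (k : ℝ) : H →L[ℝ] H :=
  -(k • B.comp (ContinuousLinearMap.adjoint B))

theorem inner_feedback (z w : H) : inner ℝ (feedback B k σ z) w =
    -inner ℝ (σ (√k • ContinuousLinearMap.adjoint B z)) (√k • ContinuousLinearMap.adjoint B w) := by
  rw [feedback, inner_neg_left, inner_smul_left, inner_smul_right,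
    ContinuousLinearMap.adjoint_inner_right]
  rfl

theorem inner_linearFeedback (hk : 0 < k) (z w : H) : inner ℝ (linearFeedback B k z) w =
    -inner ℝ (√k • ContinuousLinearMap.adjoint B z) (√k • ContinuousLinearMap.adjoint B w) := by
  simp only [linearFeedback, neg_apply, smul_apply,
    ContinuousLinearMap.comp_apply, inner_neg_left, inner_smul_left, inner_smul_right,
    ContinuousLinearMap.adjoint_inner_right, map_smul, conj_trivial]
  rw [← mul_assoc, Real.mul_self_sqrt hk.le]

theorem feedback_dissipative (hσ : IsNonlinearDamping σ) (a b : H) :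
    inner ℝ (feedback B k σ a - feedback B k σ b) (a - b) ≤ 0 := by
  have h := hσ.monotone (√k • ContinuousLinearMap.adjoint B a) (√k • ContinuousLinearMap.adjoint B b)
  rw [inner_sub_left, inner_feedback, inner_feedback, map_sub, smul_sub]
  rw [inner_sub_left] at h
  linarith

theorem locallyLipschitz_feedback (hσ : IsNonlinearDamping σ) :
    LocallyLipschitz (feedback B k σ) := by
  have h1 : LocallyLipschitz fun u : U => -(√k • B u) :=
    (-(√k • B)).lipschitz.locallyLipschitz
  have h2 : LocallyLipschitz fun z : H => √k • ContinuousLinearMap.adjoint B z :=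
    (√k • ContinuousLinearMap.adjoint B).lipschitz.locallyLipschitz
  exact h1.comp (hσ.locallyLipschitz.comp h2)

theorem IsNonlinearDamping.map_zero (hσ : IsNonlinearDamping σ) : σ 0 = 0 := by
  obtain ⟨C₁, C₂, -, -, h, -, -, -, -, hle⟩ := hσ.linear_bound
  have := hle 0
  rw [smul_zero, sub_zero, inner_zero_right, mul_zero] at this
  exact norm_le_zero_iff.1 this

theorem feedback_zero (hσ : IsNonlinearDamping σ) : feedback B k σ 0 = 0 := by
  simp [feedback, hσ.map_zero]

/-- On bounded sets a damping function grows at most linearly. -/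
theorem IsNonlinearDamping.exists_norm_le_mul (hσ : IsNonlinearDamping σ) (R : ℝ) :
    ∃ L : ℝ, 0 ≤ L ∧ ∀ s, ‖s‖ ≤ R → ‖σ s‖ ≤ L * ‖s‖ := by
  obtain ⟨K, V, hV, hK⟩ := hσ.locallyLipschitz 0
  obtain ⟨ε, hε, hεV⟩ := Metric.nhds_basis_ball.mem_iff.1 hV
  obtain ⟨M, hM⟩ := isBounded_iff_forall_norm_le.1
    (hσ.bounded (Metric.closedBall 0 R) Metric.isBounded_closedBall)
  -- Near `0` the Lipschitz bound and `σ 0 = 0` apply; for `‖s‖ ≥ ε` a constant bound `|M|` is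
  -- itself linear in `‖s‖`.
  refine ⟨max K (|M| / ε), le_max_of_le_left K.2, fun s hs => ?_⟩
  rcases lt_or_ge ‖s‖ ε with hlt | hge
  · have h1 := hK.dist_le_mul s (hεV (by simpa using hlt)) 0 (mem_of_mem_nhds hV)
    rw [hσ.map_zero, dist_zero_right, dist_zero_right] at h1
    exact h1.trans (by gcongr; exact le_max_left _ _)
  · have h1 : ‖σ s‖ ≤ |M| :=
      (hM _ (mem_image_of_mem _ (by simpa using hs))).trans (le_abs_self M)
    have h2 : |M| ≤ |M| / ε * ‖s‖ := by
      rw [div_mul_eq_mul_div, le_div_iff₀ hε]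
      gcongr
    exact (h1.trans h2).trans (by gcongr; exact le_max_right _ _)

/-- On bounded sets the deviation of a damping function from the identity is controlled by the
dissipated power. -/
theorem IsNonlinearDamping.exists_norm_sub_sq_le (hσ : IsNonlinearDamping σ) (R : ℝ) :
    ∃ c : ℝ, 0 ≤ c ∧ ∀ s, ‖s‖ ≤ R → ‖s - σ s‖ ^ 2 ≤ c * inner ℝ (σ s) s := by
  obtain ⟨L, hL, hσL⟩ := hσ.exists_norm_le_mul R
  obtain ⟨C₁, C₂, hC₁, hC₂, h, -, hmono, hnonneg, -, hle⟩ := hσ.linear_bound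
  have hd : 0 ≤ 1 + C₂ * h R * |R| := by
    have := hnonneg R
    positivity
  refine ⟨(1 + L) ^ 2 * ((1 + C₂ * h R * |R|) / C₁), by positivity, fun s hs => ?_⟩
  have hin : 0 ≤ inner ℝ (σ s) s := by simpa [hσ.map_zero] using hσ.monotone s 0
  have h1 : ‖s - σ s‖ ≤ (1 + L) * ‖s‖ := by
    linarith [norm_sub_le s (σ s), hσL s hs]
  -- Testing `C₁ s - σ s` against `s` gives `C₁ ‖s‖² ≤ ⟨σ s, s⟩ + ‖σ s - C₁ s‖ ‖s‖`, and the last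
  -- product is controlled by `⟨σ s, s⟩`.
  have h2 : ‖s‖ ^ 2 ≤ (1 + C₂ * h R * |R|) / C₁ * inner ℝ (σ s) s := by
    have e1 : inner ℝ (C₁ • s - σ s) s = C₁ * ‖s‖ ^ 2 - inner ℝ (σ s) s := by
      rw [inner_sub_left, inner_smul_left, real_inner_self_eq_norm_sq]
      simp
    have e2 := real_inner_le_norm (C₁ • s - σ s) s
    rw [norm_sub_rev] at e2
    have e3 : ‖σ s - C₁ • s‖ ≤ C₂ * h R * inner ℝ (σ s) s :=
      (hle s).trans (by gcongr; exact hmono hs)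
    have e4 : ‖σ s - C₁ • s‖ * ‖s‖ ≤ C₂ * h R * inner ℝ (σ s) s * |R| := by
      have := hnonneg R
      exact mul_le_mul e3 (hs.trans (le_abs_self R)) (norm_nonneg _) (by positivity)
    rw [div_mul_eq_mul_div, le_div_iff₀ hC₁]
    linarith
  calc ‖s - σ s‖ ^ 2 ≤ ((1 + L) * ‖s‖) ^ 2 := by gcongr
    _ = (1 + L) ^ 2 * ‖s‖ ^ 2 := by ring
    _ ≤ (1 + L) ^ 2 * ((1 + C₂ * h R * |R|) / C₁ * inner ℝ (σ s) s) := by gcongr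
    _ = _ := by ring

theorem mem_graph_linearClosedLoop (x y : H) :
    (x, y) ∈ (linearClosedLoop A B k).graph ↔ (x, y - linearFeedback B k x) ∈ A.graph := by
  simp only [LinearPMap.mem_graph_iff]
  have happ : ∀ v : A.domain, (linearClosedLoop A B k) v = A v + linearFeedback B k v := by
    intro v
    rw [linearFeedback, neg_apply, ← sub_eq_add_neg]
    rfl
  constructor
  · rintro ⟨v, hv, hy⟩
    refine ⟨v, hv, ?_⟩
    have := happ v
    rw [eq_sub_iff_add_eq, ← hy, ← hv]
    exact this.symm
  · rintro ⟨v, hv, hy⟩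
    refine ⟨v, hv, (happ v).trans ?_⟩
    rw [hy, hv, sub_add_cancel]

/-! ### Comparison of the nonlinear with the linear closed loop -/

/-- The distance between the nonlinear and the linear evolution is controlled by the energy that
the nonlinear evolution dissipates. -/
theorem norm_sub_sq_le_of_isMildOn (hS : IsContractionSemigroup S)
    (hc : Continuous fun p : ℝ × H => S p.1 p.2) (hk : 0 < k) (hσ : IsNonlinearDamping σ)
    {x : H} {τ c : ℝ} (hτ : 0 ≤ τ) {z w : ℝ → H} (hz : IsMildOn S (feedback B k σ) x τ z)
    (hw : IsMildOn S (linearFeedback B k) x τ w) (hc0 : 0 ≤ c)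
    (hdev : ∀ s ∈ Icc 0 τ, ‖√k • ContinuousLinearMap.adjoint B (z s) -
        σ (√k • ContinuousLinearMap.adjoint B (z s))‖ ^ 2 ≤
      c * inner ℝ (σ (√k • ContinuousLinearMap.adjoint B (z s)))
        (√k • ContinuousLinearMap.adjoint B (z s))) :
    ‖z τ - w τ‖ ^ 2 ≤ c / 4 * (‖x‖ ^ 2 - ‖z τ‖ ^ 2) := by
  have hFc : Continuous (feedback B k σ) := (locallyLipschitz_feedback hσ).continuous
  have hGc : Continuous (linearFeedback B k) := (linearFeedback B k).continuous
  set p : ℝ → ℝ := fun s => inner ℝ (σ (√k • ContinuousLinearMap.adjoint B (z s)))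
        (√k • ContinuousLinearMap.adjoint B (z s)) with hp
  have hpF : ∀ s, inner ℝ (feedback B k σ (z s)) (z s) = -p s := fun s => inner_feedback _ _
  have hpc : Continuous p := by
    have : p = fun s => -inner ℝ (feedback B k σ (z s)) (z s) := by
      funext s; rw [hpF, neg_neg]
    rw [this]
    exact ((hFc.comp' hz.cont).inner hz.cont).neg
  have henergy : 2 * ∫ s in (0 : ℝ)..τ, p s ≤ ‖x‖ ^ 2 - ‖z τ‖ ^ 2 := by
    have h1 := norm_mildSol_sq_le hS hc x (hFc.comp' hz.cont) hτ
    have h2 : ∫ s in (0 : ℝ)..τ, 2 * inner ℝ (feedback B k σ (z s))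
        (mildSol S x (fun s => feedback B k σ (z s)) s) = ∫ s in (0 : ℝ)..τ, (-2) * p s := by
      refine intervalIntegral.integral_congr fun s hs => ?_
      rw [uIcc_of_le hτ] at hs
      simp only [← hz.eq s hs, hpF]
      ring
    rw [← hz.eq τ ⟨hτ, le_rfl⟩, h2, intervalIntegral.integral_const_mul] at h1
    linarith
  have hfc : Continuous fun s => feedback B k σ (z s) - linearFeedback B k (w s) :=
    (hFc.comp' hz.cont).sub (hGc.comp' hw.cont)
  have heq : ∀ s ∈ Icc 0 τ, z s - w s =
      mildSol S 0 (fun s => feedback B k σ (z s) - linearFeedback B k (w s)) s := fun s hs => by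
    rw [hz.eq s hs, hw.eq s hs, mildSol_sub hc x x (hFc.comp' hz.cont) (hGc.comp' hw.cont),
      sub_self]
  have hcomp := norm_mildSol_sq_le hS hc 0 hfc hτ
  rw [← heq τ ⟨hτ, le_rfl⟩, norm_zero] at hcomp
  have hmono : ∫ s in (0 : ℝ)..τ, 2 * inner ℝ (feedback B k σ (z s) - linearFeedback B k (w s))
      (mildSol S 0 (fun s => feedback B k σ (z s) - linearFeedback B k (w s)) s) ≤
      ∫ s in (0 : ℝ)..τ, c / 2 * p s := by
    refine intervalIntegral.integral_mono_on hτ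
      (Continuous.intervalIntegrable ?_ _ _) ((hpc.const_mul _).intervalIntegrable _ _) ?_
    · exact (hfc.inner (continuous_mildSol hc 0 hfc)).const_mul 2
    · intro s hs
      rw [← heq s hs, inner_sub_left, inner_feedback, inner_linearFeedback hk]
      have hd := hdev s hs
      change _ ≤ c * p s at hd
      have hwz : √k • ContinuousLinearMap.adjoint B (w s) =
          √k • ContinuousLinearMap.adjoint B (z s) -
          √k • ContinuousLinearMap.adjoint B (z s - w s) := by
        rw [map_sub, smul_sub, sub_sub_cancel]
      rw [hwz]
      set a := √k • ContinuousLinearMap.adjoint B (z s)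
      set b := √k • ContinuousLinearMap.adjoint B (z s - w s)
      have h1 : inner ℝ (a - b) b = inner ℝ a b - ‖b‖ ^ 2 := by
        rw [inner_sub_left, real_inner_self_eq_norm_sq]
      have h2 : inner ℝ (a - σ a) b = inner ℝ a b - inner ℝ (σ a) b := inner_sub_left _ _ _
      have h3 := real_inner_le_norm (a - σ a) b
      rw [h1]
      -- Young's inequality: `2 ⟨a - σ a, b⟩ - 2 ‖b‖² ≤ ‖a - σ a‖² / 2`. The linear damping of the
      -- difference absorbs the `b` terms.
      nlinarith [sq_nonneg (‖a - σ a‖ - 2 * ‖b‖)]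
  calc ‖z τ - w τ‖ ^ 2 ≤ ∫ s in (0 : ℝ)..τ, c / 2 * p s := by linarith
    _ = c / 4 * (2 * ∫ s in (0 : ℝ)..τ, p s) := by
      rw [intervalIntegral.integral_const_mul]; ring
    _ ≤ _ := by gcongr

/-! ### Decay -/

/-- An approximate contraction estimate on all time intervals forces decay like `1 / (1 + t)`. -/
theorem exists_le_div_of_le_mul_add {q : ℝ} (hq0 : 0 ≤ q) (hq1 : q < 1) :
    ∃ K > 0, ∀ (E : ℝ → ℝ) (E₀ P : ℝ), 0 ≤ E₀ → 0 ≤ P → (∀ t, 0 ≤ t → E t ≤ E₀) →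
      (∀ t τ, 0 ≤ t → 0 ≤ τ → E (t + τ) ≤ q * E t + P / (1 + τ)) →
      ∀ t, 0 ≤ t → E t ≤ K * (E₀ + P) / (1 + t) := by
  have hq : 0 < 1 - q := sub_pos.2 hq1
  -- Any `l` strictly between `q` and `1` contracts, since passing from `1 + s = l (1 + t)` to `1 +
  -- t` costs the factor `q / l < 1`.
  set l : ℝ := (1 + q) / 2 with hl
  have hl0 : 0 < l := by positivity
  have hl1 : l < 1 := by linarith
  -- For this `K` the forcing `P / (1 - l)` equals `K P (1 - q) / 2`, exactly the slack left by `q /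
  -- l ≤ 1 - (1 - q) / 2`.
  refine ⟨4 / (1 - q) ^ 2, by positivity, fun E E₀ P hE₀ hP hbd hstep => ?_⟩
  set K : ℝ := 4 / (1 - q) ^ 2 with hK
  have hKq : K * (1 - q) ^ 2 = 4 := div_mul_cancel₀ _ (by positivity)
  have hK4 : 4 ≤ K := by
    rw [hK, le_div_iff₀ (by positivity)]
    nlinarith
  have hshort : ∀ t, 0 ≤ t → (1 + t) * l ≤ 1 → E t ≤ K * (E₀ + P) / (1 + t) := by
    intro t ht htl
    rw [le_div_iff₀ (by positivity)]
    have h2 : 1 + t ≤ 2 := by nlinarith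
    calc E t * (1 + t) ≤ E₀ * (1 + t) := by gcongr; exact hbd t ht
      _ ≤ E₀ * 2 := by gcongr
      _ ≤ K * (E₀ + P) := by nlinarith
  -- Here `n` bounds the number of times `1 + t` must be shrunk by `l` to reach the range of short
  -- times.
  have hind : ∀ n : ℕ, ∀ t, 0 ≤ t → (1 + t) * l ^ n ≤ 1 → E t ≤ K * (E₀ + P) / (1 + t) := by
    intro n
    induction n with
    | zero =>
      intro t ht h
      exact hshort t ht (by nlinarith [pow_zero l])
    | succ n ih =>
      intro t ht h
      rcases le_or_gt ((1 + t) * l) 1 with hle | hgt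
      · exact hshort t ht hle
      · set s := (1 + t) * l - 1 with hs
        have hs0 : 0 ≤ s := by linarith
        have h1s : 1 + s = (1 + t) * l := by rw [hs]; ring
        have ihs := ih s hs0 (by rw [h1s, mul_assoc, ← pow_succ']; exact h)
        have hτ : 0 ≤ t - s := by rw [hs]; nlinarith
        have h1 := hstep s (t - s) hs0 hτ
        rw [add_sub_cancel] at h1
        have h1t : 0 < 1 + t := by positivity
        have h2 : P / (1 + (t - s)) ≤ P / ((1 + t) * (1 - l)) := by
          have h3 : 0 < (1 + t) * (1 - l) := mul_pos h1t (by linarith)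
          gcongr
          rw [hs]; linarith
        have h4 : q * E s ≤ q * (K * (E₀ + P) / ((1 + t) * l)) := by
          rw [h1s] at ihs
          gcongr
        refine (h1.trans (add_le_add h4 h2)).trans ?_
        rw [show q * (K * (E₀ + P) / ((1 + t) * l)) + P / ((1 + t) * (1 - l)) =
          (q / l * (K * (E₀ + P)) + P / (1 - l)) / (1 + t) by
            have : 1 - l ≠ 0 := by linarith
            field_simp]
        gcongr
        have h5 : q / l ≤ 1 - (1 - q) / 2 := by
          rw [div_le_iff₀ hl0, hl]; nlinarith
        have h6 : P / (1 - l) = P * (K * (1 - q) / 2) := by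
          rw [div_eq_iff (by linarith), hl]
          linear_combination (-(P / 4)) * hKq
        rw [h6]
        have h7 : q / l * (K * (E₀ + P)) ≤ (1 - (1 - q) / 2) * (K * (E₀ + P)) := by
          gcongr
        nlinarith [mul_nonneg (mul_nonneg (by linarith : 0 ≤ K) hq.le) hE₀]
  intro t ht
  obtain ⟨n, hn⟩ := exists_pow_lt_of_lt_one (inv_pos.2 (by positivity : 0 < 1 + t)) hl1
  refine hind n t ht ?_
  rw [← le_inv_mul_iff₀ (by positivity), mul_one]
  exact hn.le

end Damping

/-! ### Strong solutions and decay for the nonlinear closed loop -/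

section ClosedLoop

variable {S : ℝ → H →L[ℝ] H} {A : H →ₗ.[ℝ] H} {B : U →L[ℝ] H} {k : ℝ} {σ : U → U}

/-- On bounded sets the nonlinear feedback grows at most linearly. -/
theorem exists_norm_feedback_le (hσ : IsNonlinearDamping σ) (r : ℝ) :
    ∃ L : ℝ, 0 ≤ L ∧ ∀ z : H, ‖z‖ ≤ r → ‖feedback B k σ z‖ ≤ L * ‖z‖ := by
  set Q : H →L[ℝ] U := √k • ContinuousLinearMap.adjoint B with hQ
  obtain ⟨L, hL, hσL⟩ := hσ.exists_norm_le_mul (‖Q‖ * r)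
  refine ⟨‖√k • B‖ * (L * ‖Q‖), by positivity, fun z hz => ?_⟩
  have h1 : ‖Q z‖ ≤ ‖Q‖ * ‖z‖ := Q.le_opNorm z
  have h2 := hσL (Q z) (h1.trans (by gcongr))
  calc ‖feedback B k σ z‖ = ‖(√k • B) (σ (Q z))‖ := norm_neg _
    _ ≤ ‖√k • B‖ * ‖σ (Q z)‖ := ContinuousLinearMap.le_opNorm _ _
    _ ≤ ‖√k • B‖ * (L * (‖Q‖ * ‖z‖)) := by
      gcongr
      exact h2.trans (by gcongr)
    _ = _ := by ring

theorem IsMildOn.norm_le (hS : IsContractionSemigroup S)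
    (hc : Continuous fun p : ℝ × H => S p.1 p.2) (hσ : IsNonlinearDamping σ) {x : H} {z : ℝ → H}
    (hz : ∀ a, IsMildOn S (feedback B k σ) x a z) {t : ℝ} (ht : 0 ≤ t) : ‖z t‖ ≤ ‖x‖ := by
  simpa using (hz t).norm_sub_le hS hc (locallyLipschitz_feedback hσ).continuous
    (feedback_dissipative hσ) (isMildOn_zero (feedback_zero hσ) t) ⟨ht, le_rfl⟩

/-- Mild solutions of the nonlinear closed loop starting in the domain are strong solutions. -/
theorem isStrongSolution_of_isMildOn (hL : IsGenerator A S) (hS : IsContractionSemigroup S)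
    (hc : Continuous fun p : ℝ × H => S p.1 p.2) (hσ : IsNonlinearDamping σ) (z₀ : A.domain)
    {z : ℝ → H} (hz : ∀ a, IsMildOn S (feedback B k σ) z₀ a z) :
    IsStrongSolution (nonlinearClosedLoop A B k σ) z₀ z := by
  have hFc : Continuous (feedback B k σ) := (locallyLipschitz_feedback hσ).continuous
  have hdiss := feedback_dissipative (B := B) (k := k) hσ
  have hgraph : ((z₀ : H), A z₀) ∈ A.graph := A.mem_graph z₀
  obtain ⟨L, hL0, hFL⟩ := exists_norm_feedback_le (B := B) (k := k) hσ ‖(z₀ : H)‖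
  have hM : ∀ t, 0 ≤ t → ‖feedback B k σ (z t)‖ ≤ L * ‖(z₀ : H)‖ := fun t ht => by
    have h1 := IsMildOn.norm_le hS hc hσ hz ht
    exact (hFL _ h1).trans (by gcongr)
  choose! g hg hgC using fun t (ht : 0 ≤ t) =>
    IsMildOn.exists_mem_graph hL hS hc hFc hdiss hgraph hz hM ht
  refine ⟨(hz 0).init hS le_rfl, fun T hT => ?_, fun t ht => ?_, ?_⟩
  · refine LipschitzOnWith.absolutelyContinuousOnInterval
      (K := (‖A z₀‖ + L * ‖(z₀ : H)‖).toNNReal) (LipschitzOnWith.of_dist_le_mul ?_)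
    rw [uIcc_of_le hT.le, Real.coe_toNNReal _ (by positivity)]
    intro s hs t ht
    rcases le_total s t with hst | hst
    · rw [dist_comm, dist_comm s, dist_eq_norm, Real.dist_eq, abs_of_nonneg (sub_nonneg.2 hst)]
      exact IsMildOn.norm_sub_le_mul hL hS hc hFc hdiss hgraph hz hM hs.1 hst
    · rw [dist_eq_norm, Real.dist_eq, abs_of_nonneg (sub_nonneg.2 hst)]
      exact IsMildOn.norm_sub_le_mul hL hS hc hFc hdiss hgraph hz hM ht.1 hst
  · exact LinearPMap.mem_domain_of_mem_graph (hg t ht)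
  · filter_upwards [IsMildOn.ae_hasDerivAt hL hS hc hFc hz hM hg hgC] with t ht ht0
    have h1 : A ⟨z t, LinearPMap.mem_domain_of_mem_graph (hg t ht0.le)⟩ = g t :=
      LinearPMap.mem_graph_snd_inj' A (A.mem_graph _) (hg t ht0.le) rfl
    have h2 := ht ht0
    rwa [← h1, feedback, ← sub_eq_add_neg] at h2

theorem nonlinearClosedLoop_dissipative (hL : IsGenerator A S) (hS : IsContractionSemigroup S)
    (hσ : IsNonlinearDamping σ) (a b : A.domain) :
    inner ℝ (nonlinearClosedLoop A B k σ a - nonlinearClosedLoop A B k σ b) ((a : H) - b) ≤ 0 := by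
  have h1 := hL.inner_nonpos hS (A.mem_graph (a - b))
  have h2 := feedback_dissipative (B := B) (k := k) hσ a b
  rw [LinearPMap.map_sub] at h1
  have h3 : nonlinearClosedLoop A B k σ a - nonlinearClosedLoop A B k σ b =
      (A a - A b) + (feedback B k σ a - feedback B k σ b) := by
    simp only [nonlinearClosedLoop, feedback]
    abel
  rw [h3, inner_add_left]
  exact add_nonpos h1 h2

/-- Decay of mild solutions of the nonlinear closed loop that start in a ball of the domain. -/
theorem exists_norm_le_div_of_isMildOn (hL : IsGenerator A S) (hS : IsContractionSemigroup S)
    (hc : Continuous fun p : ℝ × H => S p.1 p.2) (hk : 0 < k) (hσ : IsNonlinearDamping σ)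
    {γ : ℝ} (hγ : 1 / 2 ≤ γ) (hlin : IsPolynomiallyStable (linearClosedLoop A B k) γ)
    (r : ℝ) : ∃ C > 0, ∀ z₀ : A.domain, graphNorm A z₀ ≤ r → ∀ z : ℝ → H,
      (∀ a, IsMildOn S (feedback B k σ) z₀ a z) → ∀ t, 0 ≤ t →
        ‖z t‖ ≤ C / (1 + t) ^ (1 / 2 : ℝ) * graphNorm A z₀ := by
  have hFc : Continuous (feedback B k σ) := (locallyLipschitz_feedback hσ).continuous
  have hdiss := feedback_dissipative (B := B) (k := k) hσ
  obtain ⟨-, C, hC, hdecay⟩ := hlin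
  obtain ⟨T, hT, hTL, hTm⟩ := exists_perturbed_semigroup hL hS hc (linearFeedback B k)
    (fun a => by
      rw [inner_linearFeedback hk, real_inner_self_eq_norm_sq]
      exact neg_nonpos.2 (sq_nonneg _))
    (mem_graph_linearClosedLoop (A := A) (B := B) (k := k))
  obtain ⟨L, hL0, hFL⟩ := exists_norm_feedback_le (B := B) (k := k) hσ r
  obtain ⟨c, hc0, hdev⟩ := hσ.exists_norm_sub_sq_le
    (‖√k • ContinuousLinearMap.adjoint B‖ * r)
  -- This `q` appears on solving `E(t + τ) ≤ 2 ‖T τ (z t)‖² + (c / 2) (E(t) - E(t + τ))` for `E(t +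
  -- τ)`.
  have hq1 : c / 2 / (1 + c / 2) < 1 := by
    rw [div_lt_one (by positivity)]; linarith
  obtain ⟨K, hK, hdec⟩ := exists_le_div_of_le_mul_add (q := c / 2 / (1 + c / 2))
    (by positivity) hq1
  -- Ratio of the graph norm for the linear loop along the trajectory to the initial graph norm: `2
  -- L` is from the bound on `A (z t)`, the operator norm from the change of generator.
  set D : ℝ := 1 + 2 * L + ‖linearFeedback B k‖ with hD
  have hD0 : 0 < D := by positivity
  -- The decay lemma is applied with `E₀ = N²` and `P = 2 (C D N)²`; both are homogeneous in `N`, so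
  -- the square root leaves one factor `N`.
  refine ⟨√(K * (1 + 2 * (C * D) ^ 2)), by positivity, fun z₀ hr z hz t ht => ?_⟩
  set N := graphNorm A z₀ with hN
  have hxN : ‖(z₀ : H)‖ ≤ N := le_add_of_nonneg_right (norm_nonneg _)
  have hN0 : 0 ≤ N := (norm_nonneg _).trans hxN
  have hzx : ∀ t, 0 ≤ t → ‖z t‖ ≤ ‖(z₀ : H)‖ := fun t ht => IsMildOn.norm_le hS hc hσ hz ht
  have hM : ∀ t, 0 ≤ t → ‖feedback B k σ (z t)‖ ≤ L * ‖(z₀ : H)‖ := fun t ht =>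
    (hFL _ ((hzx t ht).trans (hxN.trans hr))).trans (by gcongr; exact hzx t ht)
  have hTz : ∀ t τ, 0 ≤ t → 0 ≤ τ → ‖T τ (z t)‖ ^ 2 ≤ (C * D * N) ^ 2 / (1 + τ) := by
    intro t τ ht hτ
    obtain ⟨v, hv, hvle⟩ :=
      IsMildOn.exists_mem_graph hL hS hc hFc hdiss (A.mem_graph z₀) hz hM ht
    have hgr : (z t, v + linearFeedback B k (z t)) ∈ (linearClosedLoop A B k).graph := by
      rw [mem_graph_linearClosedLoop, add_sub_cancel_right]
      exact hv
    obtain ⟨p, hp1, hp2⟩ := (LinearPMap.mem_graph_iff _).1 hgr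
    have h1 := hdecay T hT hTL p τ hτ
    simp only at hp1 hp2
    have h2 : graphNorm (linearClosedLoop A B k) p ≤ D * N := by
      rw [graphNorm, hp1, hp2]
      have e1 := norm_add_le v (linearFeedback B k (z t))
      have e2 := (linearFeedback B k).le_opNorm (z t)
      have e3 : ‖linearFeedback B k‖ * ‖z t‖ ≤ ‖linearFeedback B k‖ * N := by
        gcongr
        exact (hzx t ht).trans hxN
      have e4 : L * ‖(z₀ : H)‖ ≤ L * N := by gcongr
      have e5 : N = ‖(z₀ : H)‖ + ‖A z₀‖ := rfl
      have e6 := hzx t ht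
      rw [hD]
      linarith
    have h1τ : (1 : ℝ) ≤ 1 + τ := by linarith
    have h3 : √(1 + τ) ≤ (1 + τ) ^ γ := by
      rw [Real.sqrt_eq_rpow]
      exact Real.rpow_le_rpow_of_exponent_le h1τ hγ
    have h4 : 0 < √(1 + τ) := Real.sqrt_pos.2 (by positivity)
    rw [hp1] at h1
    have h5 : ‖T τ (z t)‖ ≤ C * D * N / √(1 + τ) := by
      calc ‖T τ (z t)‖ ≤ C / (1 + τ) ^ γ * graphNorm (linearClosedLoop A B k) p := h1
        _ ≤ C / (1 + τ) ^ γ * (D * N) := by gcongr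
        _ ≤ C / √(1 + τ) * (D * N) := by gcongr
        _ = _ := by ring
    calc ‖T τ (z t)‖ ^ 2 ≤ (C * D * N / √(1 + τ)) ^ 2 := by gcongr
      _ = _ := by rw [div_pow, Real.sq_sqrt (by positivity)]
  have hstep : ∀ t τ, 0 ≤ t → 0 ≤ τ → ‖z (t + τ)‖ ^ 2 ≤
      c / 2 / (1 + c / 2) * ‖z t‖ ^ 2 + 2 * (C * D * N) ^ 2 / (1 + τ) := by
    intro t τ ht hτ
    have h1 := norm_sub_sq_le_of_isMildOn hS hc hk hσ hτ
      ((hz (t + τ)).shift hS hc hFc ht hτ) (hTm (z t) τ) hc0 (fun s hs => by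
        refine hdev _ ?_
        refine ((√k • ContinuousLinearMap.adjoint B).le_opNorm (z (t + s))).trans ?_
        gcongr
        exact (hzx _ (add_nonneg ht hs.1)).trans (hxN.trans hr))
    have h2 : ‖z (t + τ)‖ ^ 2 ≤ 2 * ‖T τ (z t)‖ ^ 2 + 2 * ‖z (t + τ) - T τ (z t)‖ ^ 2 := by
      have := norm_le_norm_add_norm_sub' (z (t + τ)) (T τ (z t))
      nlinarith [sq_nonneg (‖T τ (z t)‖ - ‖z (t + τ) - T τ (z t)‖), norm_nonneg (z (t + τ)),
        norm_nonneg (T τ (z t)), norm_nonneg (z (t + τ) - T τ (z t))]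
    have h3 := hTz t τ ht hτ
    set P := (C * D * N) ^ 2 / (1 + τ) with hP
    have hP0 : 0 ≤ P := by positivity
    have h4 : ‖z (t + τ)‖ ^ 2 * (1 + c / 2) ≤ c / 2 * ‖z t‖ ^ 2 + 2 * P := by linarith
    rw [mul_div_assoc, ← hP, div_mul_eq_mul_div]
    have h5 : c / 2 * ‖z t‖ ^ 2 / (1 + c / 2) + 2 * P =
        (c / 2 * ‖z t‖ ^ 2 + 2 * P * (1 + c / 2)) / (1 + c / 2) := by
      field_simp
    rw [h5, le_div_iff₀ (by positivity)]
    nlinarith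
  have hfin := hdec (fun t => ‖z t‖ ^ 2) (N ^ 2) (2 * (C * D * N) ^ 2) (by positivity)
    (by positivity) (fun t ht => by
      have := (hzx t ht).trans hxN
      gcongr) hstep t ht
  have h1t : 0 < 1 + t := by positivity
  rw [← Real.sqrt_eq_rpow]
  refine le_of_sq_le_sq (hfin.trans_eq ?_) (by positivity)
  rw [mul_pow (_ / _) N, div_pow, Real.sq_sqrt (by positivity), Real.sq_sqrt h1t.le]
  ring

end ClosedLoop

end NonlinearDamping

end

theorem mainTheorem2 {H U : Type*}
    [NormedAddCommGroup H] [InnerProductSpace ℝ H] [CompleteSpace H]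
    [NormedAddCommGroup U] [InnerProductSpace ℝ U] [CompleteSpace U]
    (A : H →ₗ.[ℝ] H) (hA : NonlinearDamping.GeneratesContractionSemigroup A)
    (B : U →L[ℝ] H) (k : ℝ) (hk : 0 < k)
    (σ : U → U) (hσ : NonlinearDamping.IsNonlinearDamping σ)
    (γ : ℝ) (hγ : 1 / 2 < γ)
    (hlin : NonlinearDamping.IsPolynomiallyStable
      (NonlinearDamping.linearClosedLoop A B k) γ) :
    ∃ W : ℝ → A.domain → H,
      NonlinearDamping.IsStrongFlow (NonlinearDamping.nonlinearClosedLoop A B k σ) W ∧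
        NonlinearDamping.IsSemiGloballyPolynomiallyStable A W (1 / 2) := by
  obtain ⟨T, hT, hAT⟩ := hA
  have hS := hT.extend
  have hL := hAT.extend
  have hc := hT.continuous_extend
  choose z hz using NonlinearDamping.exists_forall_isMildOn hS hc
    (NonlinearDamping.locallyLipschitz_feedback (B := B) (k := k) hσ)
    (NonlinearDamping.feedback_dissipative hσ)
  refine ⟨fun t z₀ => z z₀ t, fun z₀ => ?_, by norm_num, fun r _ => ?_⟩
  · have hstrong := NonlinearDamping.isStrongSolution_of_isMildOn hL hS hc hσ z₀ (hz z₀)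
    exact ⟨hstrong, fun w hw t ht => hstrong.eq_of_dissipative
      (NonlinearDamping.nonlinearClosedLoop_dissipative hL hS hσ) hw ht⟩
  · obtain ⟨C, hC, h⟩ := NonlinearDamping.exists_norm_le_div_of_isMildOn hL hS hc hk hσ hγ.le hlin r
    exact ⟨C, hC, fun z₀ hz₀ t ht => h z₀ hz₀ _ (hz z₀) t ht⟩
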